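/- Let $d\ge 1$ and $n\ge 4$ be integers and let $\rho>0$. Let $U_1,\dots,U_n$ be independent random vectors, uniformly distributed over the cube $C_n=[0,n^{1/d})^d$. Equip $C_n$ with the Euclidean toroidal metric $D(x,y)=\min_{k\in\mathbb Z^d}\|x-y-n^{1/d}k\|$, and let $B_\rho(x)=\{y\in C_n: D(x,y)\le\rho\}$. Let $$V=\operatorname{Volume}\Big(\bigcup_{i=1}^n B_\rho(U_i)\Big),\qquad \mu_V=\mathbb E[V],\qquad \sigma_V=\operatorname{SD}(V)=\sqrt{\operatorname{Var}(V)},$$ and put $\pi_d=\pi^{d/2}/\Gamma(1+d/2)$ and $\phi=\pi_d\rho^d$. Suppose that $n>6^d\phi$. Then $0<\sigma_V<\infty$, and, with $Z$ a standard normal random variable, $$\sup_{t\in\mathbb R}\left|P\left[\frac{V-\mu_V}{\sigma_V}\le t\right]-P[Z\le t]\right|\le\frac{\mu_V}{5\sigma_V^2}\left(\sqrt{\frac{11\phi^2}{\sigma_V}+\frac{5\sqrt{\eta_V(n,\rho)}}{\sqrt n}}+\frac{2\phi}{\sqrt{\sigma_V}}\right)^2,$$ where $$\begin{aligned}\eta_V(n,\rho)={}&2\phi^2\big((3^d+1)\phi+1\big)^2\left(1+(2^d+1)6^d\phi+\left(\frac{2n-6^d\phi}{n-6^d\phi}\right)6^{2d}\phi^2\right)\\&+2\phi^4\left(3(4^d+2^d)\phi+3(4^d)\phi^2\left(\frac{2n-3(2^d)\phi}{n-3(2^d)\phi}\right)+4+\frac2n\right).\end{aligned}$$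 -/

import Mathlib

open MeasureTheory ProbabilityTheory

namespace Coverage

noncomputable section

/-- The side length `n ^ (1/d)` of the `d`-dimensional cube of volume `n`. -/
def side (d n : ℕ) : ℝ := (n : ℝ) ^ (1 / (d : ℝ))

/-- The cube `C_n = [0, n ^ (1/d)) ^ d`, which serves as a fundamental domain of the torus. -/
def cube (d n : ℕ) : Set (EuclideanSpace ℝ (Fin d)) :=
  {x | ∀ i, x i ∈ Set.Ico 0 (side d n)}

/-- The lattice translation vector `n ^ (1/d) • k` for `k ∈ ℤ ^ d`. -/
def latticeVec (d n : ℕ) (k : Fin d → ℤ) : EuclideanSpace ℝ (Fin d) :=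
  WithLp.toLp 2 fun i => side d n * (k i : ℝ)

/-- The Euclidean toroidal metric: the least Euclidean distance from `x` to a translate of `y` by
a vector of the lattice `n ^ (1/d) ℤ ^ d`. -/
def torusDist (d n : ℕ) (x y : EuclideanSpace ℝ (Fin d)) : ℝ :=
  ⨅ k : Fin d → ℤ, dist x (y + latticeVec d n k)

/-- The closed ball of radius `r` about `x` in the torus, as a subset of the cube. -/
def torusBall (d n : ℕ) (r : ℝ) (x : EuclideanSpace ℝ (Fin d)) :
    Set (EuclideanSpace ℝ (Fin d)) :=
  {y | y ∈ cube d n ∧ torusDist d n x y ≤ r}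

/-- The volume of the part of the torus covered by the balls of radius `ρ` centered at the
points `u 0, …, u (n - 1)`. -/
def coveredVolume (d n : ℕ) (ρ : ℝ) (u : Fin n → EuclideanSpace ℝ (Fin d)) : ℝ :=
  volume.real (⋃ i, torusBall d n ρ (u i))

/-- The standard deviation of a real random variable. -/
def stdDev {Ω : Type*} [MeasurableSpace Ω] (P : Measure Ω) (X : Ω → ℝ) : ℝ :=
  √(variance X P)

/-- The Kolmogorov distance between the law of `(X - E X) / SD X` and the standard normal law. -/
def kolmogorovDist {Ω : Type*} [MeasurableSpace Ω] (P : Measure Ω) (X : Ω → ℝ) : ℝ :=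
  ⨆ t : ℝ, |P.real {ω | (X ω - ∫ ω', X ω' ∂P) / stdDev P X ≤ t}
    - (gaussianReal 0 1).real (Set.Iic t)|

/-- The volume `π_d = π ^ (d/2) / Γ(1 + d/2)` of the unit ball in dimension `d`. -/
def unitBallVolume (d : ℕ) : ℝ :=
  Real.pi ^ ((d : ℝ) / 2) / Real.Gamma (1 + (d : ℝ) / 2)

/-- `φ = π_d ρ ^ d`. -/
def phi (d : ℕ) (ρ : ℝ) : ℝ := unitBallVolume d * ρ ^ d

/-- The explicit quantity `η_V(n, ρ)` in dimension `d`. -/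
def etaV (d n : ℕ) (ρ : ℝ) : ℝ :=
  2 * phi d ρ ^ 2 * ((3 ^ d + 1) * phi d ρ + 1) ^ 2
      * (1 + (2 ^ d + 1) * 6 ^ d * phi d ρ
        + (2 * n - 6 ^ d * phi d ρ) / (n - 6 ^ d * phi d ρ) * 6 ^ (2 * d) * phi d ρ ^ 2)
    + 2 * phi d ρ ^ 4
      * (3 * (4 ^ d + 2 ^ d) * phi d ρ
        + 3 * 4 ^ d * phi d ρ ^ 2
          * ((2 * n - 3 * 2 ^ d * phi d ρ) / (n - 3 * 2 ^ d * phi d ρ))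
        + 4 + 2 / n)

end

end Coverage

/-! The proof is Stein's method with a size-bias coupling. Let X be the covered volume, with mean μ
and standard deviation σ. Since X is an integral over x of the indicator that x is covered, E[X
g(X)] is an average over x of expectations of g(X) restricted to the event that x is covered. By
homogeneity of the torus that event has the same probability q for every x. Only the number N of
points falling in the ball around x, a binomial variable, has to be conditioned, and N given N > 0
can be coupled with N so that they differ by at most one. Conditioning on x being covered therefore
amounts to moving at most one point into its ball, and this changes X by at most n p ≤ φ, where p is
the normalized volume of a ball.

This gives an exact identity (`integral_hit_eq`, `integral_coverMass_mul`): E[(X - μ) g(X)] is μ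
times the mean increment of g under a weighted move of total weight at most 1. The moves are carried
by an explicit weight (`moveWeight`) instead of an auxiliary random variable, so everything lives on
the original product space.

Let W be the standardized X. Stein's equation is solved for a ramp of width a, a piecewise linear
approximation of a half-line indicator. The error splits into a variance term, the fluctuation of
the conditional drift of the coupling, and a Taylor remainder. The remainder involves P(z < W ≤ z +
a), which is itself bounded by 0.4 a + 2 κ, with κ the Kolmogorov distance. This yields an
inequality for κ in terms of κ, and a suitable choice of a closes it (`le_of_forall_smoothing`,
`kolmogorov_le_of_standardized`).

The variance of the drift is controlled by bounded differences
(`variance_pi_le_of_bounded_differences`). Relocating one point changes the drift by at most 2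
(φ/n)(1 + 2·3^d φ), because only centers x within 3ρ of the old or the new position are seriously
affected (`abs_coverDrift_update_sub_le`). The resulting variance is at most η_V / n, and a part of
the first summand of η_V already suffices (`sq_le_etaV`). Positivity of σ is proved separately, by
letting all points cluster near the origin (`stdDev_coverMass_unif_pos`). -/

namespace Coverage

/-! ### The standard normal distribution -/

/-- The standard normal density. -/
noncomputable def normalDensity (x : ℝ) : ℝ := gaussianPDFReal 0 1 x

/-- The standard normal distribution function. -/
noncomputable def normalCDF (x : ℝ) : ℝ := (gaussianReal 0 1).real (Set.Iic x)

/-- The standard normal tail function. -/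
noncomputable def normalTail (x : ℝ) : ℝ := (gaussianReal 0 1).real (Set.Ioi x)

lemma normalDensity_eq (x : ℝ) :
    normalDensity x = (√(2 * Real.pi))⁻¹ * Real.exp (-(x ^ 2) / 2) := by
  simp [normalDensity, gaussianPDFReal_def]

lemma normalDensity_pos (x : ℝ) : 0 < normalDensity x :=
  gaussianPDFReal_pos 0 1 x one_ne_zero

lemma continuous_normalDensity : Continuous normalDensity := by
  have : normalDensity = fun x => (√(2 * Real.pi))⁻¹ * Real.exp (-(x ^ 2) / 2) :=
    funext normalDensity_eq
  rw [this]; fun_prop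

lemma hasDerivAt_normalDensity (x : ℝ) :
    HasDerivAt normalDensity (-(x * normalDensity x)) x := by
  have h : normalDensity = fun x => (√(2 * Real.pi))⁻¹ * Real.exp (-(x ^ 2) / 2) :=
    funext normalDensity_eq
  rw [h]
  have h1 : HasDerivAt (fun x : ℝ => -(x ^ 2) / 2) (-x) x := by
    refine ((hasDerivAt_pow 2 x).fun_neg.div_const 2).congr_deriv ?_
    norm_num
    ring
  refine (h1.exp.const_mul (√(2 * Real.pi))⁻¹).congr_deriv ?_
  ring

lemma integrable_normalDensity : Integrable normalDensity :=
  integrable_gaussianPDFReal 0 1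

lemma two_le_sqrt_two_pi : 2.5 ≤ √(2 * Real.pi) := by
  apply Real.le_sqrt_of_sq_le
  have := Real.pi_gt_d2
  linarith

lemma sqrt_two_pi_le : √(2 * Real.pi) ≤ 2.52 := by
  rw [Real.sqrt_le_left (by norm_num)]
  have := Real.pi_lt_d2
  linarith

lemma normalDensity_le (x : ℝ) : normalDensity x ≤ 0.4 := by
  rw [normalDensity_eq]
  have h1 : Real.exp (-(x ^ 2) / 2) ≤ 1 := by
    rw [Real.exp_le_one_iff]; have := sq_nonneg x; linarith
  have h2 : (√(2 * Real.pi))⁻¹ ≤ 0.4 := by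
    rw [inv_le_comm₀ (by linarith [two_le_sqrt_two_pi]) (by norm_num)]
    have := two_le_sqrt_two_pi
    norm_num at *; linarith
  calc _ ≤ 0.4 * (1 : ℝ) := by gcongr
    _ = _ := by ring

lemma setIntegral_gaussian (s : Set ℝ) (hs : MeasurableSet s) (k : ℝ → ℝ) :
    ∫ x in s, k x ∂(gaussianReal 0 1) = ∫ x in s, k x * normalDensity x := by
  rw [← integral_indicator hs, integral_gaussianReal_eq_integral_smul one_ne_zero,
    ← integral_indicator hs]
  congr 1
  ext x
  by_cases hx : x ∈ s <;> simp [hx, normalDensity, mul_comm]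

lemma gaussian_real_eq (s : Set ℝ) (hs : MeasurableSet s) :
    (gaussianReal 0 1).real s = ∫ x in s, normalDensity x := by
  have := setIntegral_gaussian s hs (fun _ => 1)
  simpa using this

lemma normalCDF_add_tail (w : ℝ) : normalCDF w + normalTail w = 1 := by
  have := probReal_add_probReal_compl (μ := gaussianReal 0 1) (s := Set.Iic w) measurableSet_Iic
  rwa [Set.compl_Iic] at this

lemma normalCDF_nonneg (w : ℝ) : 0 ≤ normalCDF w := measureReal_nonneg
lemma normalTail_nonneg (w : ℝ) : 0 ≤ normalTail w := measureReal_nonneg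

lemma normalCDF_eq_tail_neg (w : ℝ) : normalCDF w = normalTail (-w) := by
  have h : (gaussianReal 0 1).map (fun x => -x) = gaussianReal 0 1 := by
    rw [gaussianReal_map_neg]; simp
  have := nullSingletonClass_gaussianReal (μ := 0) (v := 1) one_ne_zero
  unfold normalCDF normalTail
  conv_lhs => rw [← h]
  rw [map_measureReal_apply measurable_neg measurableSet_Iic]
  have : (fun x : ℝ => -x) ⁻¹' Set.Iic w = Set.Ici (-w) := by
    ext x; simp
  rw [this]
  exact measureReal_congr Ioi_ae_eq_Ici.symm

/-- The Mills-ratio bound: the density at w is the integral over x > w of x times the density, and x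
≥ w there. -/
lemma mul_normalTail_le (w : ℝ) : w * normalTail w ≤ normalDensity w := by
  have hint : Integrable (fun x => x * normalDensity x) := by
    have := (integrable_mul_exp_neg_mul_sq (b := 1 / 2) (by norm_num)).const_mul
      (√(2 * Real.pi))⁻¹
    refine this.congr (ae_of_all _ fun x => ?_)
    simp only [normalDensity_eq]
    rw [show -(1 / 2) * x ^ 2 = -(x ^ 2) / 2 by ring]; ring
  have htend : Filter.Tendsto (fun x => -normalDensity x) Filter.atTop (nhds 0) := by
    have h1 : Filter.Tendsto (fun x : ℝ => Real.exp (-(x ^ 2) / 2)) Filter.atTop (nhds 0) := by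
      apply Real.tendsto_exp_atBot.comp
      have : Filter.Tendsto (fun x : ℝ => x ^ 2 / 2) Filter.atTop Filter.atTop :=
        (Filter.tendsto_pow_atTop (by norm_num)).atTop_div_const (by norm_num)
      have := Filter.tendsto_neg_atTop_atBot.comp this
      refine this.congr fun x => ?_
      simp [neg_div]
    have h2 := (h1.const_mul (√(2 * Real.pi))⁻¹).neg
    simp only [mul_zero, neg_zero] at h2
    refine h2.congr fun x => ?_
    rw [normalDensity_eq]
  have hI : ∫ x in Set.Ioi w, x * normalDensity x = normalDensity w := by
    have := integral_Ioi_of_hasDerivAt_of_tendsto' (a := w) (f := fun x => -normalDensity x)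
      (f' := fun x => x * normalDensity x) (m := 0)
      (fun x _ => by simpa using (hasDerivAt_normalDensity x).fun_neg) hint.integrableOn htend
    rw [this]; simp
  rw [← hI, normalTail, gaussian_real_eq _ measurableSet_Ioi, ← integral_const_mul]
  refine setIntegral_mono_on (integrable_normalDensity.const_mul w).integrableOn
    hint.integrableOn measurableSet_Ioi fun x hx => ?_
  exact mul_le_mul_of_nonneg_right (le_of_lt hx) (normalDensity_pos x).le

lemma neg_mul_normalCDF_le (w : ℝ) : -w * normalCDF w ≤ normalDensity w := by
  rw [normalCDF_eq_tail_neg]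
  have := mul_normalTail_le (-w)
  simpa [normalDensity_eq] using this

lemma normalTail_zero : normalTail 0 = 1 / 2 := by
  have h1 := normalCDF_add_tail 0
  have h2 := normalCDF_eq_tail_neg 0
  rw [neg_zero] at h2
  linarith

/-- For x, w ≥ 0 one has (x + w)² ≥ x² + w², so the tail at w is at most exp(-w²/2) times the tail
at 0, which is 1/2. The constant bounds √(2π)/2. -/
lemma normalTail_le {w : ℝ} (hw : 0 ≤ w) : normalTail w ≤ 1.26 * normalDensity w := by
  have h1 : normalTail w = ∫ x in Set.Ioi 0, normalDensity (x + w) := by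
    rw [normalTail, gaussian_real_eq _ measurableSet_Ioi]
    rw [← integral_indicator measurableSet_Ioi, ← integral_indicator measurableSet_Ioi,
      ← integral_add_right_eq_self _ w]
    congr 1
    ext x
    simp [Set.indicator_apply]
  have h0 : normalTail 0 = ∫ x in Set.Ioi 0, normalDensity x := by
    rw [normalTail, gaussian_real_eq _ measurableSet_Ioi]
  have h2 : normalTail w ≤ Real.exp (-(w ^ 2) / 2) * normalTail 0 := by
    rw [h1, h0, ← integral_const_mul]
    refine setIntegral_mono_on (integrable_normalDensity.comp_add_right w).integrableOn
      (integrable_normalDensity.const_mul _).integrableOn measurableSet_Ioi fun x hx => ?_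
    rw [normalDensity_eq, normalDensity_eq]
    have hx : 0 < x := hx
    have : Real.exp (-((x + w) ^ 2) / 2) ≤ Real.exp (-(w ^ 2) / 2) * Real.exp (-(x ^ 2) / 2) := by
      rw [← Real.exp_add, Real.exp_le_exp]
      nlinarith [mul_nonneg hx.le hw]
    calc _ ≤ (√(2 * Real.pi))⁻¹ * (Real.exp (-(w ^ 2) / 2) * Real.exp (-(x ^ 2) / 2)) := by gcongr
      _ = _ := by ring
  rw [normalTail_zero] at h2
  have h3 : Real.exp (-(w ^ 2) / 2) = √(2 * Real.pi) * normalDensity w := by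
    rw [normalDensity_eq, mul_inv_cancel_left₀]
    linarith [two_le_sqrt_two_pi]
  have := sqrt_two_pi_le
  have := normalDensity_pos w
  rw [h3] at h2
  nlinarith

lemma normalCDF_mul_tail_le (w : ℝ) : normalCDF w * normalTail w ≤ 1.26 * normalDensity w := by
  have h := normalCDF_add_tail w
  have h1 := normalCDF_nonneg w
  have h2 := normalTail_nonneg w
  rcases le_total 0 w with hw | hw
  · have := normalTail_le hw
    nlinarith
  · have h3 := normalTail_le (w := -w) (by linarith)
    rw [← normalCDF_eq_tail_neg] at h3
    have h4 : normalDensity (-w) = normalDensity w := by simp [normalDensity_eq]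
    rw [h4] at h3
    nlinarith

/-! ### The Stein equation -/

/-- The piecewise linear function equal to `1` on `(-∞, z]` and to `0` on `[z + a, ∞)`. -/
noncomputable def ramp (z a w : ℝ) : ℝ := max 0 (min 1 ((z + a - w) / a))

lemma ramp_nonneg (z a w : ℝ) : 0 ≤ ramp z a w := le_max_left _ _
lemma ramp_le_one (z a w : ℝ) : ramp z a w ≤ 1 := max_le zero_le_one (min_le_left _ _)
lemma continuous_ramp (z a : ℝ) : Continuous (ramp z a) := by unfold ramp; fun_prop

lemma ramp_antitone (z : ℝ) {a : ℝ} (ha : 0 < a) : Antitone (ramp z a) := by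
  intro x y hxy
  unfold ramp
  gcongr

lemma ramp_eq_one {z a w : ℝ} (ha : 0 < a) (hw : w ≤ z) : ramp z a w = 1 := by
  unfold ramp
  rw [min_eq_left, max_eq_right zero_le_one]
  rw [le_div_iff₀ ha]; linarith

lemma ramp_eq_zero {z a w : ℝ} (ha : 0 < a) (hw : z + a ≤ w) : ramp z a w = 0 := by
  unfold ramp
  apply max_eq_left
  exact (min_le_right _ _).trans (div_nonpos_of_nonpos_of_nonneg (by linarith) ha.le)

section Stein

variable {h : ℝ → ℝ}

lemma integrable_gaussian_of_unit (hc : Continuous h) (h0 : ∀ x, 0 ≤ h x) (h1 : ∀ x, h x ≤ 1)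
    {μ : Measure ℝ} [IsFiniteMeasure μ] : Integrable h μ :=
  Integrable.of_bound hc.aestronglyMeasurable 1 (ae_of_all _ fun x => by
    rw [Real.norm_eq_abs, abs_of_nonneg (h0 x)]; exact h1 x)

/-- The solution of the Stein equation `f' w - w f w = h w - ∫ h dγ`. -/
noncomputable def steinSol (h : ℝ → ℝ) (w : ℝ) : ℝ :=
  (∫ x in Set.Iic w, (h x - ∫ y, h y ∂gaussianReal 0 1) ∂gaussianReal 0 1) / normalDensity w

lemma hasDerivAt_steinSol (hc : Continuous h) (h0 : ∀ x, 0 ≤ h x) (h1 : ∀ x, h x ≤ 1) (w : ℝ) :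
    HasDerivAt (steinSol h) (w * steinSol h w + (h w - ∫ y, h y ∂gaussianReal 0 1)) w := by
  set c := ∫ y, h y ∂gaussianReal 0 1
  set k : ℝ → ℝ := fun x => (h x - c) * normalDensity x
  have hk : Continuous k := (hc.sub continuous_const).mul continuous_normalDensity
  have hki : Integrable k := by
    refine integrable_normalDensity.bdd_mul (c := 1 + |c|)
      (hc.sub continuous_const).aestronglyMeasurable (ae_of_all _ fun x => ?_)
    refine (norm_sub_le _ _).trans ?_
    rw [Real.norm_eq_abs, Real.norm_eq_abs, abs_of_nonneg (h0 x)]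
    linarith [h1 x]
  have hF : ∀ v, ∫ x in Set.Iic v, (h x - c) ∂gaussianReal 0 1
      = (∫ x in Set.Iic 0, k x) + ∫ x in (0 : ℝ)..v, k x := by
    intro v
    rw [setIntegral_gaussian _ measurableSet_Iic,
      ← intervalIntegral.integral_Iic_sub_Iic hki.integrableOn hki.integrableOn]
    ring
  have hd : HasDerivAt (fun v => ∫ x in Set.Iic v, (h x - c) ∂gaussianReal 0 1) (k w) w := by
    simp_rw [hF]
    refine HasDerivAt.const_add _ ?_
    exact intervalIntegral.integral_hasDerivAt_right hki.intervalIntegrable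
      (hk.stronglyMeasurableAtFilter _ _) hk.continuousAt
  have hm := (normalDensity_pos w).ne'
  refine (hd.fun_div (hasDerivAt_normalDensity w) hm).congr_deriv ?_
  unfold steinSol
  field_simp
  simp only [k]
  ring

/-- The data describing the size of the Stein solution at `w`. -/
lemma steinSol_repr (hc : Continuous h) (h0 : ∀ x, 0 ≤ h x) (h1 : ∀ x, h x ≤ 1)
    (hanti : Antitone h) (w : ℝ) :
    ∃ A B : ℝ, h w * normalCDF w ≤ A ∧ A ≤ normalCDF w ∧ 0 ≤ B ∧ B ≤ h w * normalTail w ∧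
      steinSol h w = (normalTail w * A - normalCDF w * B) / normalDensity w ∧
      ∫ y, h y ∂gaussianReal 0 1 = A + B := by
  have hi : Integrable h (gaussianReal 0 1) := integrable_gaussian_of_unit hc h0 h1
  have hsum : ∫ y, h y ∂gaussianReal 0 1 = (∫ y in Set.Iic w, h y ∂gaussianReal 0 1)
      + ∫ y in Set.Ioi w, h y ∂gaussianReal 0 1 := by
    rw [← Set.compl_Iic, integral_add_compl measurableSet_Iic hi]
  refine ⟨∫ y in Set.Iic w, h y ∂gaussianReal 0 1, ∫ y in Set.Ioi w, h y ∂gaussianReal 0 1,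
    ?_, ?_, ?_, ?_, ?_, hsum⟩
  · have : ∫ y in Set.Iic w, h w ∂gaussianReal 0 1 = h w * normalCDF w := by
      simp [normalCDF, mul_comm]
    rw [← this]
    exact setIntegral_mono_on (integrable_const _).integrableOn hi.integrableOn measurableSet_Iic
      fun x hx => hanti hx
  · have : ∫ y in Set.Iic w, (1 : ℝ) ∂gaussianReal 0 1 = normalCDF w := by
      simp [normalCDF]
    rw [← this]
    exact setIntegral_mono_on hi.integrableOn (integrable_const _).integrableOn measurableSet_Iic
      fun x _ => h1 x
  · exact setIntegral_nonneg measurableSet_Ioi fun x _ => h0 x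
  · have : ∫ y in Set.Ioi w, h w ∂gaussianReal 0 1 = h w * normalTail w := by
      simp [normalTail, mul_comm]
    rw [← this]
    exact setIntegral_mono_on hi.integrableOn (integrable_const _).integrableOn measurableSet_Ioi
      fun x hx => hanti (le_of_lt hx)
  · unfold steinSol
    congr 1
    rw [integral_sub hi.integrableOn (integrable_const _).integrableOn, hsum]
    have : ∀ c : ℝ, ∫ y in Set.Iic w, c ∂gaussianReal 0 1 = c * normalCDF w := by
      intro c; simp [normalCDF, mul_comm]
    rw [this]
    -- With A and B the integrals of `h` over the two half-lines, A - (A + B) Φ = (1 - Φ) A - Φ B.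
    linear_combination (∫ y in Set.Iic w, h y ∂gaussianReal 0 1) * -(normalCDF_add_tail w)

/-- In the representation by A and B, monotonicity of `h` makes the solution nonnegative, and A ≤ Φ,
B ≥ 0 bound it by Φ(1 - Φ) over the density. -/
lemma abs_steinSol_le (hc : Continuous h) (h0 : ∀ x, 0 ≤ h x) (h1 : ∀ x, h x ≤ 1)
    (hanti : Antitone h) (w : ℝ) : |steinSol h w| ≤ 1.26 := by
  obtain ⟨A, B, hA, hA', hB, hB', he, -⟩ := steinSol_repr hc h0 h1 hanti w
  have hm := normalDensity_pos w
  have h2 := normalCDF_nonneg w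
  have h3 := normalTail_nonneg w
  have h4 := normalCDF_mul_tail_le w
  rw [he, abs_of_nonneg]
  · rw [div_le_iff₀ hm]
    nlinarith [mul_le_mul_of_nonneg_left hA' h3, mul_nonneg h2 hB]
  · apply div_nonneg _ hm.le
    nlinarith [mul_le_mul_of_nonneg_left hA h3, mul_le_mul_of_nonneg_left hB' h2]

lemma abs_deriv_steinSol_le (hc : Continuous h) (h0 : ∀ x, 0 ≤ h x) (h1 : ∀ x, h x ≤ 1)
    (hanti : Antitone h) (w : ℝ) :
    |w * steinSol h w + (h w - ∫ y, h y ∂gaussianReal 0 1)| ≤ 1 := by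
  obtain ⟨A, B, hA, hA', hB, hB', he, hs⟩ := steinSol_repr hc h0 h1 hanti w
  have hm := normalDensity_pos w
  have hP := normalCDF_nonneg w
  have hT := normalTail_nonneg w
  have hPT := normalCDF_add_tail w
  set Φ := normalCDF w
  set Ψ := normalTail w
  set m := normalDensity w
  set x := h w
  have hx0 : 0 ≤ x := h0 w
  have hx1 : x ≤ 1 := h1 w
  set a := w * Ψ / m with ha
  set b := w * Φ / m with hb
  have ha1 : a ≤ 1 := by rw [ha, div_le_one hm]; exact mul_normalTail_le w
  have hb1 : -1 ≤ b := by
    rw [hb, le_div_iff₀ hm]; linarith [neg_mul_normalCDF_le w]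
  have hab : a * Φ = b * Ψ := by rw [ha, hb]; ring
  -- The derivative is affine in A and B with coefficients a - 1 ≤ 0 and -(b + 1) ≤ 0, the signs
  -- being the Mills-ratio bounds. The extreme admissible values of A and B therefore give the two
  -- estimates.
  have hform : w * steinSol h w + (h w - ∫ y, h y ∂gaussianReal 0 1)
      = x + A * (a - 1) - B * (b + 1) := by
    rw [he, hs, ha, hb]; ring
  rw [hform, abs_le]
  have k2 : A * (a - 1) ≤ x * Φ * (a - 1) := mul_le_mul_of_nonpos_right hA (by linarith)
  have k4 : 0 ≤ B * (b + 1) := mul_nonneg hB (by linarith)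
  have k5 : a * Φ ≤ Φ := by nlinarith
  have k6 : -Ψ ≤ a * Φ := by rw [hab]; nlinarith
  constructor
  · have e1 : x + Φ * (a - 1) - x * Ψ * (b + 1) = (1 - x) * (a * Φ - Φ) := by
      have e2 : x * Ψ * (b + 1) = x * (a * Φ) + x * (1 - Φ) := by
        rw [hab]; linear_combination x * hPT
      rw [e2]; ring
    nlinarith [mul_nonneg (sub_nonneg.2 hx1) (show 0 ≤ a * Φ - Φ + 1 by linarith)]
  · have : x + x * Φ * (a - 1) ≤ 1 := by nlinarith
    linarith

end Stein

/-! ### Kolmogorov bounds from a weighted size-bias identity -/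

/-- The ramp is absolutely continuous with slope -1/a exactly on the interval from z to z + a.
Writing the increment as an integral lets concentration of W on short intervals control it. -/
lemma ramp_sub_ramp_le (z w : ℝ) {a t : ℝ} (ha : 0 < a) (ht : 0 ≤ t) :
    ramp z a w - ramp z a (w + t)
      ≤ a⁻¹ * ∫ r in Set.Ioc 0 t, (Set.Ioc z (z + a)).indicator (fun _ => (1 : ℝ)) (w + r) := by
  have hI : ∫ r in Set.Ioc 0 t, (Set.Ioc z (z + a)).indicator (fun _ => (1 : ℝ)) (w + r)
      = max 0 (min t (z + a - w) - max 0 (z - w)) := by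
    have h1 : (fun r => (Set.Ioc z (z + a)).indicator (fun _ => (1 : ℝ)) (w + r))
        = (Set.Ioc (z - w) (z + a - w)).indicator (fun _ => (1 : ℝ)) := by
      ext r
      simp only [Set.indicator_apply, Set.mem_Ioc]
      congr 1
      apply propext
      constructor <;> rintro ⟨h1, h2⟩ <;> constructor <;> linarith
    rw [h1, setIntegral_indicator measurableSet_Ioc, Set.Ioc_inter_Ioc]
    simp [Real.volume_real_Ioc, max_comm]
  have hr : ∀ v, ramp z a v = a⁻¹ * max 0 (min a (z + a - v)) := by
    intro v
    unfold ramp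
    rw [mul_max_of_nonneg _ _ (inv_nonneg.2 ha.le), mul_min_of_nonneg _ _ (inv_nonneg.2 ha.le),
      mul_zero, inv_mul_cancel₀ ha.ne', inv_mul_eq_div]
  rw [hI, hr, hr, ← mul_sub]
  refine mul_le_mul_of_nonneg_left ?_ (inv_nonneg.2 ha.le)
  simp only [max_def, min_def]
  split_ifs <;> linarith

lemma integrable_of_abs_le {X : Type*} [MeasurableSpace X] {μ : Measure X} [IsFiniteMeasure μ]
    {f : X → ℝ} (hf : Measurable f) (C : ℝ) (hC : ∀ x, |f x| ≤ C) : Integrable f μ :=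
  Integrable.of_bound hf.aestronglyMeasurable C (ae_of_all _ hC)

lemma abs_integral_le_of_abs_le {X : Type*} [MeasurableSpace X] {μ : Measure X} {f g : X → ℝ}
    (hg : Integrable g μ) (h : ∀ x, |f x| ≤ g x) : |∫ x, f x ∂μ| ≤ ∫ x, g x ∂μ := by
  rw [← Real.norm_eq_abs]
  exact norm_integral_le_of_norm_le hg (ae_of_all _ h)

section Shift

variable {Ω : Type*} [MeasurableSpace Ω] {P : Measure Ω} [IsProbabilityMeasure P] {W : Ω → ℝ}

lemma integral_ramp_sub_le (hW : Measurable W) {a K : ℝ} (ha : 0 < a)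
    (hK : ∀ z, P.real {ω | W ω ∈ Set.Ioc z (z + a)} ≤ K) (z : ℝ) {t : ℝ} (ht : 0 ≤ t) :
    ∫ ω, (ramp z a (W ω) - ramp z a (W ω + t)) ∂P ≤ t * K / a := by
  set I : ℝ → ℝ := (Set.Ioc z (z + a)).indicator (fun _ => (1 : ℝ)) with hIdef
  have hIm : Measurable I := measurable_const.indicator measurableSet_Ioc
  have hI0 : ∀ x, |I x| ≤ 1 := by
    intro x
    simp only [hIdef, Set.indicator_apply]
    split_ifs <;> simp
  have hprod : Integrable (Function.uncurry fun ω r => I (W ω + r))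
      (P.prod (volume.restrict (Set.Ioc 0 t))) := by
    refine integrable_of_abs_le ?_ 1 fun x => hI0 _
    exact hIm.comp ((hW.comp measurable_fst).add measurable_snd)
  have h1 : ∫ ω, (ramp z a (W ω) - ramp z a (W ω + t)) ∂P
      ≤ ∫ ω, (a⁻¹ * ∫ r in Set.Ioc 0 t, I (W ω + r)) ∂P := by
    refine integral_mono ?_ (hprod.integral_prod_left.const_mul _)
      fun ω => ramp_sub_ramp_le z (W ω) ha ht
    refine integrable_of_abs_le ?_ 2 fun ω => ?_
    · exact ((continuous_ramp z a).measurable.comp hW).sub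
        ((continuous_ramp z a).measurable.comp (hW.add_const t))
    · rw [abs_le]
      have := ramp_nonneg z a (W ω)
      have := ramp_nonneg z a (W ω + t)
      have := ramp_le_one z a (W ω)
      have := ramp_le_one z a (W ω + t)
      constructor <;> linarith
  refine h1.trans ?_
  rw [integral_const_mul, integral_integral_swap hprod]
  have h2 : ∀ r, ∫ ω, I (W ω + r) ∂P ≤ K := by
    intro r
    have : ∫ ω, I (W ω + r) ∂P = P.real {ω | W ω ∈ Set.Ioc (z - r) (z - r + a)} := by
      have hs : MeasurableSet {ω | W ω ∈ Set.Ioc (z - r) (z - r + a)} := hW measurableSet_Ioc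
      rw [← integral_indicator_one hs]
      congr 1
      ext ω
      simp only [hIdef, Set.indicator_apply, Set.mem_Ioc, Set.mem_ofPred_eq, Pi.one_apply]
      congr 1
      apply propext
      constructor <;> rintro ⟨h1, h2⟩ <;> constructor <;> linarith
    rw [this]; exact hK _
  have h3 : ∫ r in Set.Ioc 0 t, ∫ ω, I (W ω + r) ∂P ≤ ∫ r in Set.Ioc 0 t, K :=
    integral_mono hprod.integral_prod_right (integrable_const _) h2
  have h4 : ∫ r in Set.Ioc 0 t, K = t * K := by simp [ht]
  rw [h4] at h3
  rw [div_eq_inv_mul]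
  exact mul_le_mul_of_nonneg_left h3 (inv_nonneg.2 ha.le)

/-- The total increment of `ramp z a` over symmetric intervals about `w` of radius up to `δ`. -/
noncomputable def rampSpread (z a δ w : ℝ) : ℝ :=
  ∫ t in Set.Ioc 0 δ, (ramp z a (w - t) - ramp z a (w + t))

lemma integrable_rampSpread_prod (hW : Measurable W) (z a δ : ℝ) :
    Integrable (Function.uncurry fun ω t => ramp z a (W ω - t) - ramp z a (W ω + t))
      (P.prod (volume.restrict (Set.Ioc 0 δ))) := by
  refine integrable_of_abs_le ?_ 1 fun x => ?_
  · have h1 : Measurable fun x : Ω × ℝ => W x.1 := hW.comp measurable_fst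
    exact ((continuous_ramp z a).measurable.comp (h1.sub measurable_snd)).sub
        ((continuous_ramp z a).measurable.comp (h1.add measurable_snd))
  · simp only [Function.uncurry]
    rw [abs_le]
    have := ramp_nonneg z a (W x.1 - x.2)
    have := ramp_nonneg z a (W x.1 + x.2)
    have := ramp_le_one z a (W x.1 - x.2)
    have := ramp_le_one z a (W x.1 + x.2)
    constructor <;> linarith

lemma integral_rampSpread_le (hW : Measurable W) {a K : ℝ} (ha : 0 < a)
    (hK : ∀ z, P.real {ω | W ω ∈ Set.Ioc z (z + a)} ≤ K) (z : ℝ) {δ : ℝ} (hδ : 0 ≤ δ) :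
    ∫ ω, rampSpread z a δ (W ω) ∂P ≤ δ ^ 2 * K / a := by
  have hprod := integrable_rampSpread_prod (P := P) hW z a δ
  unfold rampSpread
  rw [integral_integral_swap hprod]
  have h1 : ∀ t ∈ Set.Ioc 0 δ, ∫ ω, (ramp z a (W ω - t) - ramp z a (W ω + t)) ∂P
      ≤ (2 * K / a) * t := by
    intro t ht
    have h2 : ∀ v s, ramp z a (v + s) = ramp (z - s) a v := by
      intro v s; unfold ramp; congr 3; ring
    -- A symmetric increment of radius t is a one-sided increment of length 2t of a translated ramp.
    -- Integrating the bound 2tK/a over t up to δ gives δ²K/a.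
    have h3 : ∀ v, ramp z a (v - t) - ramp z a (v + t)
        = ramp (z + t) a v - ramp (z + t) a (v + 2 * t) := by
      intro v; unfold ramp; congr 4 <;> ring
    simp_rw [h3]
    refine (integral_ramp_sub_le hW ha hK (z + t) (t := 2 * t) (by linarith [ht.1])).trans ?_
    apply le_of_eq; ring
  have h4 : ∫ t in Set.Ioc 0 δ, ∫ ω, (ramp z a (W ω - t) - ramp z a (W ω + t)) ∂P
      ≤ ∫ t in Set.Ioc 0 δ, (2 * K / a) * t := by
    refine setIntegral_mono_on hprod.integral_prod_right ?_ measurableSet_Ioc h1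
    exact ((continuous_const.mul continuous_id).integrableOn_Icc).mono_set Set.Ioc_subset_Icc_self
  refine h4.trans (le_of_eq ?_)
  rw [← intervalIntegral.integral_of_le hδ, intervalIntegral.integral_const_mul, integral_id]
  ring

end Shift

/-- The remainder is the integral of f'(w + t) - f'(w). Stein's equation expresses this difference
by w(f(w + t) - f(w)) + t f(w + t), handled by |f'| ≤ 1 and |f| ≤ 1.26, plus an increment of the
ramp. The increment is kept as `rampSpread` instead of being bounded by t/a, since it is small on
average. -/
lemma steinSol_taylor (z w : ℝ) {a δ D : ℝ} (ha : 0 < a) (hD : |D| ≤ δ) :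
    |steinSol (ramp z a) (w + D) - steinSol (ramp z a) w
      - (w * steinSol (ramp z a) w + (ramp z a w - ∫ y, ramp z a y ∂gaussianReal 0 1)) * D|
      ≤ δ ^ 2 / 2 * (1.26 + |w|) + rampSpread z a δ w := by
  set h := ramp z a
  set f := steinSol h
  set c := ∫ y, h y ∂gaussianReal 0 1
  have hc : Continuous h := continuous_ramp z a
  have hanti : Antitone h := ramp_antitone z ha
  have h0 : ∀ x, 0 ≤ h x := ramp_nonneg z a
  have h1 : ∀ x, h x ≤ 1 := ramp_le_one z a
  set f' : ℝ → ℝ := fun w => w * f w + (h w - c) with hf'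
  have hder : ∀ v, HasDerivAt f (f' v) v := hasDerivAt_steinSol hc h0 h1
  have hfc : Continuous f := continuous_iff_continuousAt.2 fun v => (hder v).continuousAt
  have hf'c : Continuous f' := by fun_prop
  have hfb : ∀ v, |f v| ≤ 1.26 := abs_steinSol_le hc h0 h1 hanti
  have hf'b : ∀ v, |f' v| ≤ 1 := abs_deriv_steinSol_le hc h0 h1 hanti
  have hlip : ∀ x y, |f x - f y| ≤ |x - y| := by
    intro x y
    have := Convex.norm_image_sub_le_of_norm_hasDerivWithin_le (f := f) (f' := f') (C := 1)
      (s := Set.univ) (x := y) (y := x) (fun v _ => (hder v).hasDerivWithinAt)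
      (fun v _ => hf'b v) convex_univ (Set.mem_univ _) (Set.mem_univ _)
    simpa using this
  set g : ℝ → ℝ := fun t => f' (w + t) - f' w with hg
  have hgc : Continuous g := by fun_prop
  set G : ℝ → ℝ := fun t => t * (1.26 + |w|) + (h (w - t) - h (w + t)) with hG
  have hGc : Continuous G := by fun_prop
  have hgG : ∀ t, |g t| ≤ G |t| := by
    intro t
    have e : g t = (w * (f (w + t) - f w) + t * f (w + t)) + (h (w + t) - h w) := by
      simp only [hg, hf']; ring
    have b1 : |w * (f (w + t) - f w)| ≤ |w| * |t| := by
      rw [abs_mul]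
      refine mul_le_mul_of_nonneg_left ?_ (abs_nonneg _)
      simpa using hlip (w + t) w
    have b2 : |t * f (w + t)| ≤ |t| * 1.26 := by
      rw [abs_mul]
      exact mul_le_mul_of_nonneg_left (hfb _) (abs_nonneg _)
    have b3 : |h (w + t) - h w| ≤ h (w - |t|) - h (w + |t|) := by
      rw [abs_le]
      have m1 : h (w + |t|) ≤ h (w + t) := hanti (by linarith [le_abs_self t])
      have m2 : h (w + t) ≤ h (w - |t|) := hanti (by linarith [neg_abs_le t])
      have m3 : h (w + |t|) ≤ h w := hanti (by linarith [abs_nonneg t])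
      have m4 : h w ≤ h (w - |t|) := hanti (by linarith [abs_nonneg t])
      constructor <;> linarith
    rw [e]
    refine (abs_add_le _ _).trans ?_
    have := abs_add_le (w * (f (w + t) - f w)) (t * f (w + t))
    simp only [hG]
    nlinarith
  have hG0 : ∀ t, 0 ≤ t → 0 ≤ G t := by
    intro t ht
    have := (abs_nonneg _).trans (hgG t)
    rwa [abs_of_nonneg ht] at this
  have hint : f (w + D) - f w - f' w * D = ∫ t in (0 : ℝ)..D, g t := by
    have : ∫ t in (0 : ℝ)..D, f' (w + t) = f (w + D) - f w := by
      have := intervalIntegral.integral_eq_sub_of_hasDerivAt (a := 0) (b := D)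
        (f := fun t => f (w + t)) (f' := fun t => f' (w + t))
        (fun t _ => by simpa using (hder (w + t)).comp_const_add w t)
        ((hf'c.comp (continuous_const.add continuous_id)).intervalIntegrable _ _)
      simpa using this
    simp only [hg]
    rw [intervalIntegral.integral_sub (Continuous.intervalIntegrable (by fun_prop) _ _)
      (continuous_const.intervalIntegrable _ _), this]
    simp [mul_comm]
  have hδ : 0 ≤ δ := (abs_nonneg _).trans hD
  have hext : ∀ D', 0 ≤ D' → D' ≤ δ → ∫ t in (0 : ℝ)..D', G t ≤ ∫ t in (0 : ℝ)..δ, G t := by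
    intro D' hD0 hD1
    refine intervalIntegral.integral_mono_interval le_rfl hD0 hD1 ?_ (hGc.intervalIntegrable _ _)
    refine (ae_restrict_iff' measurableSet_Ioc).2 (ae_of_all _ fun t ht => hG0 t ht.1.le)
  have hmain : |∫ t in (0 : ℝ)..D, g t| ≤ ∫ t in (0 : ℝ)..δ, G t := by
    rcases le_total 0 D with hD0 | hD0
    · refine le_trans ?_ (hext D hD0 ((le_abs_self D).trans hD))
      rw [← Real.norm_eq_abs]
      refine intervalIntegral.norm_integral_le_of_norm_le hD0 (ae_of_all _ fun t ht => ?_)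
        (hGc.intervalIntegrable _ _)
      simpa [abs_of_pos ht.1] using hgG t
    · refine le_trans ?_ (hext (-D) (by linarith) ((neg_le_abs D).trans hD))
      have : ∫ t in (0 : ℝ)..D, g t = -∫ t in (0 : ℝ)..(-D), g (-t) := by
        rw [intervalIntegral.integral_comp_neg (fun t => g t), intervalIntegral.integral_symm]
        simp
      rw [this, abs_neg, ← Real.norm_eq_abs]
      refine intervalIntegral.norm_integral_le_of_norm_le (neg_nonneg.2 hD0)
        (ae_of_all _ fun t ht => ?_) (hGc.intervalIntegrable _ _)
      simpa [abs_of_pos ht.1] using hgG (-t)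
  rw [hint]
  refine hmain.trans (le_of_eq ?_)
  simp only [hG]
  rw [intervalIntegral.integral_add (Continuous.intervalIntegrable (by fun_prop) _ _)
    (Continuous.intervalIntegrable (by fun_prop) _ _), intervalIntegral.integral_mul_const,
    integral_id, rampSpread, intervalIntegral.integral_of_le hδ]
  ring

lemma integral_abs_le_sqrt {Ω : Type*} [MeasurableSpace Ω] {P : Measure Ω}
    [IsProbabilityMeasure P] {X : Ω → ℝ} (hX : MemLp X 2 P) :
    ∫ ω, |X ω| ∂P ≤ √(∫ ω, X ω ^ 2 ∂P) := by
  apply Real.le_sqrt_of_sq_le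
  have h := variance_nonneg (fun ω => |X ω|) P
  have hX' : MemLp (fun ω => |X ω|) 2 P := hX.abs
  rw [variance_eq_sub hX'] at h
  have e : ∀ ω, ((fun ω => |X ω|) ^ 2) ω = X ω ^ 2 := fun ω => by simp
  simp only [e] at h
  linarith

/-- Beyond z the ramp is a triangle of area a/2, and the normal density is at most 0.4. -/
lemma integral_ramp_gaussian_sub_le (z : ℝ) {a : ℝ} (ha : 0 < a) :
    ∫ y, ramp z a y ∂gaussianReal 0 1 ≤ normalCDF z + 0.2 * a := by
  have hi : Integrable (ramp z a) (gaussianReal 0 1) :=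
    integrable_gaussian_of_unit (continuous_ramp z a) (ramp_nonneg z a) (ramp_le_one z a)
  rw [← integral_add_compl (measurableSet_Iic (a := z)) hi, Set.compl_Iic]
  have h1 : ∫ y in Set.Iic z, ramp z a y ∂gaussianReal 0 1 ≤ normalCDF z := by
    have : ∫ y in Set.Iic z, (1 : ℝ) ∂gaussianReal 0 1 = normalCDF z := by simp [normalCDF]
    rw [← this]
    exact integral_mono hi.integrableOn (integrable_const _) fun x => ramp_le_one z a x
  have h2 : ∫ y in Set.Ioi z, ramp z a y ∂gaussianReal 0 1 ≤ 0.2 * a := by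
    rw [setIntegral_gaussian _ measurableSet_Ioi]
    have hle : z ≤ z + a := by linarith
    rw [← Set.Ioc_union_Ioi_eq_Ioi hle]
    have hint : Integrable (fun y => ramp z a y * normalDensity y) :=
      integrable_normalDensity.bdd_mul (c := 1) (continuous_ramp z a).aestronglyMeasurable
        (ae_of_all _ fun x => by
          rw [Real.norm_eq_abs, abs_of_nonneg (ramp_nonneg z a x)]; exact ramp_le_one z a x)
    rw [setIntegral_union (Set.Ioc_disjoint_Ioi le_rfl) measurableSet_Ioi hint.integrableOn
      hint.integrableOn]
    have h3 : ∫ y in Set.Ioi (z + a), ramp z a y * normalDensity y = 0 := by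
      refine setIntegral_eq_zero_of_forall_eq_zero fun x hx => ?_
      rw [ramp_eq_zero ha (le_of_lt hx), zero_mul]
    rw [h3, add_zero]
    have h4 : ∫ y in Set.Ioc z (z + a), ramp z a y * normalDensity y
        ≤ ∫ y in Set.Ioc z (z + a), (z + a - y) * (0.4 / a) := by
      refine setIntegral_mono_on hint.integrableOn ?_ measurableSet_Ioc fun y hy => ?_
      · exact (Continuous.integrableOn_Icc (by fun_prop)).mono_set Set.Ioc_subset_Icc_self
      · have e1 : ramp z a y ≤ (z + a - y) / a := by
          refine max_le (div_nonneg (by linarith [hy.2]) ha.le) (min_le_right _ _)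
        have e2 : 0 ≤ (z + a - y) / a := div_nonneg (by linarith [hy.2]) ha.le
        calc ramp z a y * normalDensity y ≤ (z + a - y) / a * 0.4 :=
              mul_le_mul e1 (normalDensity_le y) (normalDensity_pos y).le e2
          _ = _ := by ring
    refine h4.trans (le_of_eq ?_)
    rw [← intervalIntegral.integral_of_le hle, intervalIntegral.integral_mul_const,
      intervalIntegral.integral_comp_sub_left (fun x => x) (z + a), integral_id]
    field_simp
    ring
  linarith

/-- Elimination of the smoothing parameter. -/
lemma le_of_forall_smoothing {κ M δ Δ : ℝ} (hM : 0 < M) (hδ : 0 < δ) (hΔ : 0 ≤ Δ)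
    (h : ∀ a, 0 < a → κ ≤ 0.2 * a + M * Δ + M * (1.13 * δ ^ 2 + δ ^ 2 * (0.4 * a + 2 * κ) / a)) :
    κ ≤ M / 5 * (√(11 * δ ^ 2 + 5 * Δ) + 2 * δ) ^ 2 := by
  set s := √(11 * δ ^ 2 + 5 * Δ) with hs
  have hs2 : s ^ 2 = 11 * δ ^ 2 + 5 * Δ := Real.sq_sqrt (by positivity)
  have hs0 : 0 < s := Real.sqrt_pos.2 (by positivity)
  -- This width makes the coefficient of κ on the right equal to δ/(δ + s), so that κ s/(δ + s)
  -- remains on the left.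
  have h1 := h (2 * M * δ * (δ + s)) (by positivity)
  have e1 : M * (1.13 * δ ^ 2 + δ ^ 2 * (0.4 * (2 * M * δ * (δ + s)) + 2 * κ)
      / (2 * M * δ * (δ + s))) = 1.53 * M * δ ^ 2 + κ * δ / (δ + s) := by
    field_simp; ring
  rw [e1] at h1
  have h2 : κ * s ≤ (δ + s) * (0.4 * M * δ * (δ + s) + M * Δ + 1.53 * M * δ ^ 2) := by
    have e2 : κ * s = (δ + s) * (κ - κ * δ / (δ + s)) := by field_simp; ring
    rw [e2]
    refine mul_le_mul_of_nonneg_left ?_ (by positivity)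
    linarith
  have e3 : Δ = (s ^ 2 - 11 * δ ^ 2) / 5 := by rw [hs2]; ring
  rw [e3] at h2
  have h3 : κ * s ≤ (M / 5 * (s + 2 * δ) ^ 2) * s := by
    refine h2.trans ?_
    -- One fifth of this quantity is exactly the difference of the two sides once Δ has been
    -- eliminated.
    have : 0 ≤ M * (s ^ 2 * δ + 3.35 * δ ^ 2 * s + 1.35 * δ ^ 3) := by positivity
    nlinarith
  exact le_of_mul_le_mul_right h3 hs0

section Kolmogorov

variable {Ω R : Type*} [MeasurableSpace Ω] [MeasurableSpace R] {P : Measure Ω}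
  [IsProbabilityMeasure P] {τ : Measure R} [IsFiniteMeasure τ]

/-- The Stein estimate for one ramp. The parameter `R` with its weight `l` plays the role of the
extra randomness of the coupling. The total weight may be less than 1, because leaving the
configuration unchanged contributes nothing to an increment. -/
lemma abs_integral_ramp_sub_le {W : Ω → ℝ} {W' l : Ω → R → ℝ} {M δ Δ Kb L K a : ℝ}
    (hW : Measurable W) (hW' : Measurable (Function.uncurry W'))
    (hl : Measurable (Function.uncurry l)) (hl0 : ∀ u r, 0 ≤ l u r) (hlL : ∀ u r, l u r ≤ L)
    (hl1 : ∀ u, ∫ r, l u r ∂τ ≤ 1) (hWb : ∀ u, |W u| ≤ Kb) (hδ : 0 ≤ δ) (hM : 0 ≤ M)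
    (hclose : ∀ u r, |W' u r - W u| ≤ δ) (hΔ : 0 ≤ Δ)
    (hid : ∀ g : ℝ → ℝ, Continuous g →
      ∫ u, W u * g (W u) ∂P = M * ∫ u, ∫ r, l u r * (g (W' u r) - g (W u)) ∂τ ∂P)
    (hsq : ∫ u, W u ^ 2 ∂P = 1)
    (hvar : variance (fun u => ∫ r, l u r * (W' u r - W u) ∂τ) P ≤ Δ ^ 2)
    (ha : 0 < a) (hK : ∀ z, P.real {ω | W ω ∈ Set.Ioc z (z + a)} ≤ K) (z : ℝ) :
    |∫ u, ramp z a (W u) ∂P - ∫ y, ramp z a y ∂gaussianReal 0 1|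
      ≤ M * Δ + M * (1.13 * δ ^ 2 + δ ^ 2 * K / a) := by
  set h := ramp z a
  set f := steinSol h
  set c := ∫ y, h y ∂gaussianReal 0 1
  have hc : Continuous h := continuous_ramp z a
  have hanti : Antitone h := ramp_antitone z ha
  have h0 : ∀ x, 0 ≤ h x := ramp_nonneg z a
  have h1 : ∀ x, h x ≤ 1 := ramp_le_one z a
  set f' : ℝ → ℝ := fun w => w * f w + (h w - c) with hf'
  have hder : ∀ v, HasDerivAt f (f' v) v := hasDerivAt_steinSol hc h0 h1
  have hfc : Continuous f := continuous_iff_continuousAt.2 fun v => (hder v).continuousAt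
  have hf'c : Continuous f' := by fun_prop
  have hfb : ∀ v, |f v| ≤ 1.26 := abs_steinSol_le hc h0 h1 hanti
  have hf'b : ∀ v, |f' v| ≤ 1 := abs_deriv_steinSol_le hc h0 h1 hanti
  have hW1 : Measurable fun x : Ω × R => W x.1 := hW.comp measurable_fst
  have hLabs : ∀ u r, |l u r| ≤ |L| := fun u r => by
    rw [abs_of_nonneg (hl0 u r)]; exact (hlL u r).trans (le_abs_self L)
  set T : Ω → ℝ := fun u => ∫ r, l u r * (W' u r - W u) ∂τ with hT
  have iD : Integrable (Function.uncurry fun u r => l u r * (W' u r - W u)) (P.prod τ) := by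
    refine integrable_of_abs_le (hl.mul (hW'.sub hW1)) (|L| * δ) fun x => ?_
    simp only [Function.uncurry]
    rw [abs_mul]
    exact mul_le_mul (hLabs _ _) (hclose _ _) (abs_nonneg _) (abs_nonneg _)
  have iF : Integrable (Function.uncurry fun u r => l u r * (f (W' u r) - f (W u)))
      (P.prod τ) := by
    refine integrable_of_abs_le (hl.mul ((hfc.measurable.comp hW').sub
      (hfc.measurable.comp hW1))) (|L| * 2.52) fun x => ?_
    simp only [Function.uncurry]
    rw [abs_mul]
    refine mul_le_mul (hLabs _ _) ?_ (abs_nonneg _) (abs_nonneg _)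
    refine (abs_sub _ _).trans ?_
    linarith [hfb (W' x.1 x.2), hfb (W x.1)]
  have iT : Integrable T P := iD.integral_prod_left
  have hTm : StronglyMeasurable T :=
    (hl.mul (hW'.sub hW1)).stronglyMeasurable.integral_prod_right
  have hTl : ∀ u, Measurable (l u) := fun u => hl.comp measurable_prodMk_left
  have hTW : ∀ u, Measurable (W' u) := fun u => hW'.comp measurable_prodMk_left
  have il : ∀ u, Integrable (l u) τ := fun u => integrable_of_abs_le (hTl u) _ (hLabs u)
  have hTb : ∀ u, |T u| ≤ δ := by
    intro u
    have : |T u| ≤ ∫ r, l u r * δ ∂τ := by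
      refine abs_integral_le_of_abs_le ((il u).mul_const δ) fun r => ?_
      rw [abs_mul, abs_of_nonneg (hl0 u r)]
      exact mul_le_mul_of_nonneg_left (hclose u r) (hl0 u r)
    rw [integral_mul_const] at this
    nlinarith [hl1 u]
  have hWL2 : MemLp W 2 P := MemLp.of_bound hW.aestronglyMeasurable Kb (ae_of_all _ hWb)
  have hTL2 : MemLp T 2 P := MemLp.of_bound hTm.aestronglyMeasurable δ (ae_of_all _ hTb)
  -- The identity tested with g = id. Hence 1 - M T is centered and its first absolute moment is at
  -- most M times the standard deviation of T.
  have hET : M * ∫ u, T u ∂P = 1 := by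
    have := hid id continuous_id
    simp only [id] at this
    rw [← this, ← hsq]
    congr 1; ext u; ring
  have hEW : ∫ u, |W u| ∂P ≤ 1 := by
    have := integral_abs_le_sqrt hWL2
    rwa [hsq, Real.sqrt_one] at this
  have hE1 : ∫ u, |1 - M * T u| ∂P ≤ M * Δ := by
    have hm : MemLp (fun u => 1 - M * T u) 2 P := (memLp_const 1).sub (hTL2.const_mul M)
    refine (integral_abs_le_sqrt hm).trans ?_
    rw [Real.sqrt_le_left (by positivity)]
    have hv : variance (fun u => M * T u) P = ∫ u, (1 - M * T u) ^ 2 ∂P := by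
      rw [variance_eq_integral (hTm.measurable.const_mul M).aemeasurable]
      congr 1; ext u
      rw [integral_const_mul, hET]; ring
    rw [← hv, variance_const_mul, mul_pow]
    exact mul_le_mul_of_nonneg_left hvar (sq_nonneg M)
  set S : Ω → ℝ := fun u => ∫ r, l u r * (f (W' u r) - f (W u)) ∂τ with hS
  have iS : Integrable S P := iF.integral_prod_left
  have hbd : ∀ u, |S u - f' (W u) * T u|
      ≤ δ ^ 2 / 2 * (1.26 + |W u|) + rampSpread z a δ (W u) := by
    intro u
    set C := δ ^ 2 / 2 * (1.26 + |W u|) + rampSpread z a δ (W u)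
    have hpt : ∀ r, |f (W' u r) - f (W u) - f' (W u) * (W' u r - W u)| ≤ C := by
      intro r
      have := steinSol_taylor z (W u) ha (hclose u r)
      rwa [add_sub_cancel] at this
    have hbC : 0 ≤ C := by
      have := steinSol_taylor z (W u) ha (D := 0) (δ := δ) (by simpa using hδ)
      exact (abs_nonneg _).trans this
    have i1 : Integrable (fun r => l u r * (f (W' u r) - f (W u))) τ := by
      refine integrable_of_abs_le ((hTl u).mul ((hfc.measurable.comp (hTW u)).sub_const _))
        (|L| * 2.52) fun r => ?_
      rw [abs_mul]
      refine mul_le_mul (hLabs _ _) ?_ (abs_nonneg _) (abs_nonneg _)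
      refine (abs_sub _ _).trans ?_
      linarith [hfb (W' u r), hfb (W u)]
    have i2 : Integrable (fun r => l u r * (W' u r - W u)) τ := by
      refine integrable_of_abs_le ((hTl u).mul ((hTW u).sub_const _)) (|L| * δ) fun r => ?_
      rw [abs_mul]
      exact mul_le_mul (hLabs _ _) (hclose _ _) (abs_nonneg _) (abs_nonneg _)
    have e : S u - f' (W u) * T u
        = ∫ r, l u r * (f (W' u r) - f (W u) - f' (W u) * (W' u r - W u)) ∂τ := by
      simp only [hS, hT]
      rw [← integral_const_mul, ← integral_sub i1 (i2.const_mul _)]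
      congr 1; ext r; ring
    rw [e]
    have : |∫ r, l u r * (f (W' u r) - f (W u) - f' (W u) * (W' u r - W u)) ∂τ|
        ≤ ∫ r, l u r * C ∂τ := by
      refine abs_integral_le_of_abs_le ((il u).mul_const C) fun r => ?_
      rw [abs_mul, abs_of_nonneg (hl0 u r)]
      exact mul_le_mul_of_nonneg_left (hpt r) (hl0 u r)
    rw [integral_mul_const] at this
    nlinarith [hl1 u]
  have ifT : Integrable (fun u => f' (W u) * T u) P := by
    refine integrable_of_abs_le ((hf'c.measurable.comp hW).mul hTm.measurable) (1 * δ) fun u => ?_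
    rw [abs_mul]
    exact mul_le_mul (hf'b _) (hTb u) (abs_nonneg _) zero_le_one
  have iWabs : Integrable (fun u => |W u|) P :=
    (hWL2.integrable (by norm_num)).abs
  have iR : Integrable (fun u => rampSpread z a δ (W u)) P :=
    (integrable_rampSpread_prod (P := P) hW z a δ).integral_prod_left
  -- Since E|W| ≤ 1, the first part of the remainder is at most (δ²/2)(1.26 + 1) = 1.13 δ².
  have hErr : |∫ u, (S u - f' (W u) * T u) ∂P| ≤ 1.13 * δ ^ 2 + δ ^ 2 * K / a := by
    have i3 : Integrable (fun u => δ ^ 2 / 2 * (1.26 + |W u|)) P :=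
      ((integrable_const _).add iWabs).const_mul _
    refine (abs_integral_le_of_abs_le (i3.add iR) hbd).trans ?_
    rw [integral_add' i3 iR, integral_const_mul, integral_add (integrable_const _) iWabs]
    have := integral_rampSpread_le hW ha hK z hδ
    simp only [integral_const, probReal_univ, smul_eq_mul, one_mul]
    nlinarith [sq_nonneg δ]
  have ih : Integrable (fun u => h (W u)) P :=
    integrable_of_abs_le (hc.measurable.comp hW) 1 fun u => by
      rw [abs_of_nonneg (h0 _)]; exact h1 _
  have if' : Integrable (fun u => f' (W u)) P :=
    integrable_of_abs_le (hf'c.measurable.comp hW) 1 fun u => hf'b _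
  have iWf : Integrable (fun u => W u * f (W u)) P := by
    refine integrable_of_abs_le (hW.mul (hfc.measurable.comp hW)) (|Kb| * 1.26) fun u => ?_
    rw [abs_mul]
    exact mul_le_mul ((hWb u).trans (le_abs_self _)) (hfb _) (abs_nonneg _) (abs_nonneg _)
  have hmain : ∫ u, h (W u) ∂P - c
      = ∫ u, f' (W u) * (1 - M * T u) ∂P - M * ∫ u, (S u - f' (W u) * T u) ∂P := by
    have e1 : ∫ u, h (W u) ∂P - c = ∫ u, f' (W u) ∂P - ∫ u, W u * f (W u) ∂P := by
      rw [← integral_sub if' iWf]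
      have : ∀ u, f' (W u) - W u * f (W u) = h (W u) - c := fun u => by simp only [hf']; ring
      simp_rw [this]
      rw [integral_sub ih (integrable_const _)]
      simp
    have e2 : ∫ u, f' (W u) * (1 - M * T u) ∂P
        = ∫ u, f' (W u) ∂P - M * ∫ u, f' (W u) * T u ∂P := by
      rw [← integral_const_mul, ← integral_sub if' (ifT.const_mul M)]
      congr 1; ext u; ring
    rw [e1, e2, hid f hfc, integral_sub iS ifT]
    ring
  rw [hmain]
  have hA : |∫ u, f' (W u) * (1 - M * T u) ∂P| ≤ M * Δ := by
    refine le_trans ?_ hE1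
    have i4 : Integrable (fun u => |1 - M * T u|) P :=
      ((integrable_const _).sub (iT.const_mul M)).abs
    refine abs_integral_le_of_abs_le i4 fun u => ?_
    rw [abs_mul]
    exact mul_le_of_le_one_left (abs_nonneg _) (hf'b _)
  refine (abs_sub _ _).trans ?_
  rw [abs_mul, abs_of_nonneg hM]
  have := mul_le_mul_of_nonneg_left hErr hM
  linarith

/-- The estimate is bootstrapped: the concentration needed for ramps is supplied by the unknown
Kolmogorov distance κ itself, through comparison with the normal law, and κ ≤ F(κ) is then solved.
-/
theorem kolmogorov_le_of_standardized {W : Ω → ℝ} {W' l : Ω → R → ℝ} {M δ Δ Kb L : ℝ}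
    (hW : Measurable W) (hW' : Measurable (Function.uncurry W'))
    (hl : Measurable (Function.uncurry l)) (hl0 : ∀ u r, 0 ≤ l u r) (hlL : ∀ u r, l u r ≤ L)
    (hl1 : ∀ u, ∫ r, l u r ∂τ ≤ 1) (hWb : ∀ u, |W u| ≤ Kb) (hδ : 0 < δ) (hM : 0 < M)
    (hclose : ∀ u r, |W' u r - W u| ≤ δ) (hΔ : 0 ≤ Δ)
    (hid : ∀ g : ℝ → ℝ, Continuous g →
      ∫ u, W u * g (W u) ∂P = M * ∫ u, ∫ r, l u r * (g (W' u r) - g (W u)) ∂τ ∂P)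
    (hsq : ∫ u, W u ^ 2 ∂P = 1)
    (hvar : variance (fun u => ∫ r, l u r * (W' u r - W u) ∂τ) P ≤ Δ ^ 2) :
    ⨆ t : ℝ, |P.real {u | W u ≤ t} - (gaussianReal 0 1).real (Set.Iic t)|
      ≤ M / 5 * (√(11 * δ ^ 2 + 5 * Δ) + 2 * δ) ^ 2 := by
  set κ := ⨆ t : ℝ, |P.real {u | W u ≤ t} - (gaussianReal 0 1).real (Set.Iic t)| with hκ
  have hbdd : BddAbove (Set.range fun t : ℝ =>
      |P.real {u | W u ≤ t} - (gaussianReal 0 1).real (Set.Iic t)|) := by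
    refine ⟨1, ?_⟩
    rintro _ ⟨t, rfl⟩
    have h1 : P.real {u | W u ≤ t} ≤ 1 := measureReal_le_one
    have h2 : (gaussianReal 0 1).real (Set.Iic t) ≤ 1 := measureReal_le_one
    have h3 : 0 ≤ P.real {u | W u ≤ t} := measureReal_nonneg
    have h4 : 0 ≤ (gaussianReal 0 1).real (Set.Iic t) := measureReal_nonneg
    rw [abs_le]; constructor <;> linarith
  have hle : ∀ t, |P.real {u | W u ≤ t} - normalCDF t| ≤ κ := fun t => le_ciSup hbdd t
  refine le_of_forall_smoothing hM hδ hΔ fun a ha => ?_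
  have hcdf : ∀ z, P.real {u | W u ∈ Set.Ioc z (z + a)}
      = P.real {u | W u ≤ z + a} - P.real {u | W u ≤ z} := by
    intro z
    have : {u | W u ∈ Set.Ioc z (z + a)} = {u | W u ≤ z + a} \ {u | W u ≤ z} := by
      ext u; simp [and_comm]
    have hs : MeasurableSet {u | W u ≤ z} := hW measurableSet_Iic
    rw [this, measureReal_sdiff _ hs]
    intro u hu
    have : W u ≤ z := hu
    show W u ≤ z + a
    linarith
  have hn : ∀ z, normalCDF (z + a) - normalCDF z ≤ 0.4 * a := by
    intro z
    have hzz : z ≤ z + a := by linarith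
    rw [normalCDF, normalCDF, gaussian_real_eq _ measurableSet_Iic,
      gaussian_real_eq _ measurableSet_Iic, intervalIntegral.integral_Iic_sub_Iic
      integrable_normalDensity.integrableOn integrable_normalDensity.integrableOn]
    have := intervalIntegral.integral_mono_on (μ := volume) hzz
      (continuous_normalDensity.intervalIntegrable _ _)
      (continuous_const.intervalIntegrable _ _) (fun x _ => normalDensity_le x)
    refine this.trans (le_of_eq ?_)
    rw [intervalIntegral.integral_const]
    simp
    ring
  have hK : ∀ z, P.real {ω | W ω ∈ Set.Ioc z (z + a)} ≤ 0.4 * a + 2 * κ := by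
    intro z
    rw [hcdf]
    have h1 := abs_le.1 (hle (z + a))
    have h2 := abs_le.1 (hle z)
    linarith [hn z]
  have hcore := abs_integral_ramp_sub_le hW hW' hl hl0 hlL hl1 hWb hδ.le hM.le hclose hΔ hid hsq
    hvar ha hK
  have iramp : ∀ z, Integrable (fun u => ramp z a (W u)) P := fun z =>
    integrable_of_abs_le ((continuous_ramp z a).measurable.comp hW) 1 fun u => by
      rw [abs_of_nonneg (ramp_nonneg z a _)]; exact ramp_le_one z a _
  have hind : ∀ z, ∫ u, {u | W u ≤ z}.indicator (1 : Ω → ℝ) u ∂P = P.real {u | W u ≤ z} :=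
    fun z => integral_indicator_one (hW measurableSet_Iic)
  have iind : ∀ z, Integrable ({u | W u ≤ z}.indicator (1 : Ω → ℝ)) P := fun z =>
    (integrable_const (1 : ℝ)).indicator (hW measurableSet_Iic)
  have hup : ∀ z, P.real {u | W u ≤ z} ≤ ∫ u, ramp z a (W u) ∂P := by
    intro z
    rw [← hind]
    refine integral_mono (iind z) (iramp z) fun u => ?_
    by_cases hu : W u ≤ z
    · simp [hu, ramp_eq_one ha hu]
    · simp [hu, ramp_nonneg]
  have hlo : ∀ z, ∫ u, ramp z a (W u) ∂P ≤ P.real {u | W u ≤ z + a} := by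
    intro z
    rw [← hind]
    refine integral_mono (iramp z) (iind _) fun u => ?_
    by_cases hu : W u ≤ z + a
    · simp [hu, ramp_le_one]
    · simp [hu, ramp_eq_zero ha (not_le.1 hu).le]
  -- Reflection y ↦ -y turns a ramp into 1 minus a ramp starting at -(z + a), so the upper estimate
  -- gives the lower one.
  have hglo : ∀ z, normalCDF (z + a) - 0.2 * a ≤ ∫ y, ramp z a y ∂gaussianReal 0 1 := by
    intro z
    have hi : ∀ z, Integrable (ramp z a) (gaussianReal 0 1) := fun z =>
      integrable_gaussian_of_unit (continuous_ramp z a) (ramp_nonneg z a) (ramp_le_one z a)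
    have hsym : ∫ y, ramp (-(z + a)) a y ∂gaussianReal 0 1
        = 1 - ∫ y, ramp z a y ∂gaussianReal 0 1 := by
      have hneg : (gaussianReal 0 1).map (fun x => -x) = gaussianReal 0 1 := by
        rw [gaussianReal_map_neg]; simp
      have h1 : ∫ y, ramp (-(z + a)) a y ∂gaussianReal 0 1
          = ∫ y, ramp (-(z + a)) a (-y) ∂gaussianReal 0 1 := by
        conv_lhs => rw [← hneg]
        exact integral_map measurable_neg.aemeasurable
          (continuous_ramp _ a).aestronglyMeasurable
      have h2 : ∀ y, ramp (-(z + a)) a (-y) = 1 - ramp z a y := by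
        intro y
        unfold ramp
        have : (-(z + a) + a - -y) / a = 1 - (z + a - y) / a := by field_simp; ring
        rw [this]
        simp only [max_def, min_def]
        split_ifs <;> linarith
      rw [h1]
      simp_rw [h2]
      rw [integral_sub (integrable_const _) (hi z)]
      simp
    have h3 := integral_ramp_gaussian_sub_le (-(z + a)) ha
    rw [hsym, normalCDF_eq_tail_neg, neg_neg] at h3
    linarith [normalCDF_add_tail (z + a)]
  refine ciSup_le fun t => ?_
  change |P.real {u | W u ≤ t} - normalCDF t| ≤ _
  rw [abs_le]
  constructor
  -- For the lower bound the ramp must vanish beyond t, hence it starts at t - a.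
  · have h1 := (abs_le.1 (hcore (t - a))).1
    have h2 := hlo (t - a)
    have h3 := hglo (t - a)
    rw [sub_add_cancel] at h2 h3
    linarith
  · have h1 := (abs_le.1 (hcore t)).2
    have h2 := hup t
    have h3 := integral_ramp_gaussian_sub_le t ha
    linarith

end Kolmogorov

/-! ### Variance of functions with bounded differences -/

/-- Induction on the number of coordinates by the law of total variance, conditioning on the first
one. The conditional mean ranges in an interval of length c, and a variable in such an interval has
variance at most c²/4. The conditional variance falls under the induction hypothesis. -/
lemma variance_pi_le_of_bounded_differences {E : Type*} [MeasurableSpace E] (ν : Measure E)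
    [IsProbabilityMeasure ν] (n : ℕ) (f : (Fin n → E) → ℝ) (hf : Measurable f) (b c : ℝ)
    (hb : ∀ u, |f u| ≤ b) (hc : ∀ u j y, |f (Function.update u j y) - f u| ≤ c) :
    variance f (Measure.pi fun _ => ν) ≤ n * (c ^ 2 / 4) := by
  induction n with
  | zero =>
    have : f = fun _ => f default := by
      ext u; rw [Subsingleton.elim u default]
    rw [this, variance_eq_integral aemeasurable_const]
    simp
  | succ n ih =>
    set Q := Measure.pi fun _ : Fin n => ν
    set e := MeasurableEquiv.piFinSuccAbove (fun _ : Fin (n + 1) => E) 0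
    have hmp : MeasurePreserving e.symm (ν.prod Q) (Measure.pi fun _ => ν) :=
      (measurePreserving_piFinSuccAbove (fun _ : Fin (n + 1) => ν) 0).symm
    set F : E × (Fin n → E) → ℝ := fun p => f (e.symm p) with hF
    have hFm : Measurable F := hf.comp e.symm.measurable
    have he : ∀ x v, e.symm (x, v) = Fin.cons x v := fun x v => by
      simp [e, MeasurableEquiv.piFinSuccAbove, Fin.insertNthEquiv]
    have hFb : ∀ p, |F p| ≤ b := fun p => hb _
    have hint : ∀ g : (Fin (n + 1) → E) → ℝ, ∫ u, g u ∂(Measure.pi fun _ => ν)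
        = ∫ p, g (e.symm p) ∂(ν.prod Q) := fun g => (hmp.integral_comp' g).symm
    have iF : Integrable F (ν.prod Q) := integrable_of_abs_le hFm b hFb
    have iF2 : Integrable (fun p => F p ^ 2) (ν.prod Q) := by
      refine integrable_of_abs_le (hFm.pow_const 2) (b ^ 2) fun p => ?_
      rw [abs_pow]; exact pow_le_pow_left₀ (abs_nonneg _) (hFb p) 2
    have hmem : MemLp f 2 (Measure.pi fun _ : Fin (n + 1) => ν) :=
      MemLp.of_bound hf.aestronglyMeasurable b (ae_of_all _ hb)
    set g : E → ℝ := fun x => ∫ v, F (x, v) ∂Q with hg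
    have hgm : StronglyMeasurable g := hFm.stronglyMeasurable.integral_prod_right
    have hFx : ∀ x, Measurable fun v => F (x, v) := fun x => hFm.comp measurable_prodMk_left
    have iFx : ∀ x, Integrable (fun v => F (x, v)) Q := fun x =>
      integrable_of_abs_le (hFx x) b fun v => hFb _
    have hgb : ∀ x, |g x| ≤ b := by
      intro x
      have := abs_integral_le_of_abs_le (μ := Q) (integrable_const b) fun v => hFb (x, v)
      simpa using this
    have hgL2 : MemLp g 2 ν := MemLp.of_bound hgm.aestronglyMeasurable b (ae_of_all _ hgb)
    have hosc : ∀ x y, g x - g y ≤ c := by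
      intro x y
      have : |∫ v, (F (x, v) - F (y, v)) ∂Q| ≤ ∫ v, c ∂Q := by
        refine abs_integral_le_of_abs_le (integrable_const c) fun v => ?_
        have := hc (Fin.cons y v) 0 x
        rw [Fin.update_cons_zero] at this
        simp only [hF, he]
        exact this
      rw [integral_sub (iFx x) (iFx y)] at this
      simpa using (le_abs_self _).trans this
    have hvg : variance g ν ≤ c ^ 2 / 4 := by
      have hne : Nonempty E := ν.nonempty_of_neZero
      have hbb : BddAbove (Set.range g) := ⟨b, by rintro _ ⟨x, rfl⟩; exact (abs_le.1 (hgb x)).2⟩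
      -- Pairwise differences at most c place all values in the interval of length c that ends at
      -- the supremum.
      have hh : ∀ x, g x ∈ Set.Icc ((⨆ y, g y) - c) (⨆ y, g y) := by
        intro x
        refine ⟨?_, le_ciSup hbb x⟩
        have : ⨆ y, g y ≤ g x + c := ciSup_le fun y => by linarith [hosc y x]
        linarith
      have := variance_le_sq_of_bounded (μ := ν) (ae_of_all _ hh) hgm.measurable.aemeasurable
      refine this.trans (le_of_eq ?_)
      ring
    have hin : ∀ x, variance (fun v => F (x, v)) Q ≤ n * (c ^ 2 / 4) := by
      intro x
      refine ih _ (hFx x) (fun v => hFb _) fun v j y => ?_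
      have := hc (Fin.cons x v) j.succ y
      rw [← Fin.cons_update] at this
      simp only [hF, he]
      exact this
    have hv1 : ∀ x, variance (fun v => F (x, v)) Q = ∫ v, F (x, v) ^ 2 ∂Q - g x ^ 2 := by
      intro x
      have : MemLp (fun v => F (x, v)) 2 Q :=
        MemLp.of_bound (hFx x).aestronglyMeasurable b (ae_of_all _ fun v => hFb _)
      rw [variance_eq_sub this]
      rfl
    have ig2 : Integrable (fun x => g x ^ 2) ν := hgL2.integrable_sq
    have iin : Integrable (fun x => ∫ v, F (x, v) ^ 2 ∂Q) ν := iF2.integral_prod_left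
    have htot : variance f (Measure.pi fun _ => ν)
        = ∫ x, variance (fun v => F (x, v)) Q ∂ν + variance g ν := by
      rw [variance_eq_sub hmem, variance_eq_sub hgL2]
      simp_rw [hv1]
      rw [integral_sub iin ig2, hint, hint]
      have e1 : ∫ p, (f ^ 2) (e.symm p) ∂(ν.prod Q) = ∫ x, ∫ v, F (x, v) ^ 2 ∂Q ∂ν :=
        integral_prod _ iF2
      have e2 : ∫ p, f (e.symm p) ∂(ν.prod Q) = ∫ x, g x ∂ν := integral_prod _ iF
      rw [e1, e2]
      simp only [Pi.pow_apply]
      ring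
    rw [htot]
    have : ∫ x, variance (fun v => F (x, v)) Q ∂ν ≤ ∫ x, (n * (c ^ 2 / 4) : ℝ) ∂ν := by
      refine integral_mono ?_ (integrable_const _) hin
      simp_rw [hv1]
      exact iin.sub ig2
    simp only [integral_const, probReal_univ, smul_eq_mul, one_mul] at this
    push_cast
    linarith

/-! ### The binomial distribution conditioned to be positive -/

/-- The binomial probability mass function. -/
noncomputable def binomPMF (n : ℕ) (p : ℝ) (k : ℕ) : ℝ := n.choose k * p ^ k * (1 - p) ^ (n - k)

/-- The binomial tail probability `P (N > k)`. -/
noncomputable def binomTail (n : ℕ) (p : ℝ) (k : ℕ) : ℝ :=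
  ∑ j ∈ Finset.range (n - k), binomPMF n p (k + 1 + j)

/-- The probability that a binomial variable is positive. -/
noncomputable def hitProb (n : ℕ) (p : ℝ) : ℝ := 1 - (1 - p) ^ n

/-- The weight with which a binomial count equal to `k` is increased by one in the coupling of the
binomial distribution with its conditioning on being positive. -/
noncomputable def moveProb (n : ℕ) (p : ℝ) (k : ℕ) : ℝ :=
  n / (n - k) * (binomTail n p k * ((1 - hitProb n p) / hitProb n p) / binomPMF n p k)

section Binomial

variable {n : ℕ} {p : ℝ}

lemma binomPMF_nonneg (hp : 0 < p) (hp1 : p < 1) (k : ℕ) : 0 ≤ binomPMF n p k := by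
  have : 0 < 1 - p := by linarith
  unfold binomPMF; positivity

lemma binomPMF_pos (hp : 0 < p) (hp1 : p < 1) {k : ℕ} (hk : k ≤ n) : 0 < binomPMF n p k := by
  have : 0 < 1 - p := by linarith
  have := Nat.choose_pos hk
  unfold binomPMF; positivity

lemma hitProb_pos (hp : 0 < p) (hp1 : p < 1) (hn : 0 < n) : 0 < hitProb n p := by
  unfold hitProb
  have := pow_lt_one₀ (a := 1 - p) (by linarith) (by linarith) hn.ne'
  linarith

lemma hitProb_lt_one (hp1 : p < 1) : hitProb n p < 1 := by
  unfold hitProb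
  have : 0 < (1 - p) ^ n := pow_pos (by linarith) n
  linarith

lemma binomTail_zero : binomTail n p 0 = hitProb n p := by
  have h := add_pow p (1 - p) n
  rw [add_sub_cancel, one_pow, Finset.sum_range_succ'] at h
  have h2 : binomTail n p 0
      = ∑ k ∈ Finset.range n, p ^ (k + 1) * (1 - p) ^ (n - (k + 1)) * (n.choose (k + 1) : ℝ) := by
    unfold binomTail binomPMF
    rw [Nat.sub_zero]
    refine Finset.sum_congr rfl fun j _ => ?_
    rw [zero_add, add_comm 1 j]; ring
  rw [← h2] at h
  simp only [Nat.sub_zero, pow_zero, Nat.choose_zero_right, Nat.cast_one, one_mul, mul_one] at h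
  unfold hitProb
  linarith

lemma binomTail_succ {k : ℕ} (hk : k < n) :
    binomTail n p k = binomPMF n p (k + 1) + binomTail n p (k + 1) := by
  unfold binomTail
  obtain ⟨m, rfl⟩ : ∃ m, n = k + 1 + m := ⟨n - (k + 1), by omega⟩
  rw [show k + 1 + m - k = m + 1 by omega, show k + 1 + m - (k + 1) = m by omega,
    Finset.sum_range_succ', add_comm]
  congr 1
  refine Finset.sum_congr rfl fun j _ => ?_
  congr 1; ring

lemma binomPMF_succ_mul {k : ℕ} (hk : k < n) :
    binomPMF n p (k + 1) * (k + 1) * (1 - p) = binomPMF n p k * (n - k) * p := by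
  unfold binomPMF
  have h : (n.choose (k + 1) : ℝ) * (k + 1) = n.choose k * (n - k) := by
    have := Nat.choose_succ_right_eq n k
    have h2 := congrArg (Nat.cast : ℕ → ℝ) this
    push_cast [Nat.cast_sub hk.le] at h2
    exact h2
  have h3 : (1 - p) ^ (n - k) = (1 - p) ^ (n - (k + 1)) * (1 - p) := by
    rw [← pow_succ]; congr 1; omega
  rw [h3, pow_succ]
  linear_combination (p ^ k * p * (1 - p) ^ (n - (k + 1)) * (1 - p)) * h

lemma moveProb_zero (hp : 0 < p) (hp1 : p < 1) (hn : 0 < n) : moveProb n p 0 = 1 := by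
  have h1 : (n : ℝ) ≠ 0 := by positivity
  have h2 := (hitProb_pos hp hp1 hn).ne'
  have h3 : binomPMF n p 0 = 1 - hitProb n p := by simp [binomPMF, hitProb]
  have h4 : 1 - hitProb n p ≠ 0 := by linarith [hitProb_lt_one (n := n) hp1]
  rw [moveProb, binomTail_zero, h3]
  simp only [Nat.cast_zero, sub_zero]
  field_simp

/-- The prefactor n / (n - n) is a division by zero with value 0. This is the right value: with all
points inside there is none left to move. -/
lemma moveProb_self : moveProb n p n = 0 := by simp [moveProb]

/-- Balance of inflow and outflow at count k + 1: conditioning on a positive count multiplies the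
law by the constant 1/q, with q = `hitProb n p`. Raising a count k by one with probability P(N >
k)(1 - q)/(q P(N = k)) achieves this, as comparison of tails shows. The factor n/(n - k) in
`moveProb` compensates for picking an index uniformly among all n, of which only n - k lie outside.
-/
lemma moveProb_recursion (hp : 0 < p) (hp1 : p < 1) {k : ℕ} (hk : k < n) :
    1 + ((1 - p) * (k + 1) * moveProb n p k - p * (n - (k + 1)) * moveProb n p (k + 1)) / (n * p)
      = 1 / hitProb n p := by
  have hn : 0 < n := by omega
  have h1 : (n : ℝ) ≠ 0 := by positivity
  have hq := (hitProb_pos hp hp1 hn).ne'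
  have hb := (binomPMF_pos hp hp1 hk.le).ne'
  have hb' := (binomPMF_pos hp hp1 (show k + 1 ≤ n from hk)).ne'
  have hnk : (n : ℝ) - k ≠ 0 := by
    have : (k : ℝ) < n := by exact_mod_cast hk
    linarith
  have hp' := hp.ne'
  have hrel := binomPMF_succ_mul (p := p) hk
  obtain ⟨c, hc⟩ : ∃ c, c = (1 - hitProb n p) / hitProb n p := ⟨_, rfl⟩
  -- Both flows acquire the denominator P(N = k + 1). Their numerators are consecutive tails, which
  -- differ by P(N = k + 1), so k drops out.
  have e1 : (1 - p) * (k + 1) * moveProb n p k / (n * p)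
      = binomTail n p k * c / binomPMF n p (k + 1) := by
    unfold moveProb
    rw [← hc]
    field_simp
    linear_combination (binomTail n p k * c) * hrel
  have e2 : p * (n - (k + 1)) * moveProb n p (k + 1) / (n * p)
      = binomTail n p (k + 1) * c / binomPMF n p (k + 1) := by
    rcases eq_or_ne (k + 1) n with h | h
    · have h0 : binomTail n p n = 0 := by simp [binomTail]
      rw [h, h0, moveProb_self]
      simp
    · have hnk' : (n : ℝ) - (k + 1) ≠ 0 := by
        have : (k : ℝ) + 1 < n := by
          have : k + 1 < n := by omega
          exact_mod_cast this
        linarith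
      unfold moveProb
      rw [← hc]
      push_cast
      field_simp
  rw [sub_div, e1, e2, binomTail_succ hk]
  field_simp
  rw [hc]
  field_simp
  ring

/-- Marking j elements of a (k + j)-set only increases the count, and marked sets number C(n, j) C(n
- j, k). -/
lemma choose_add_le {n k j : ℕ} (hj : 1 ≤ j) (hkj : k + j ≤ n) :
    n.choose (k + j) ≤ (n - 1).choose k * n.choose j := by
  have h := Nat.choose_mul (n := n) (k := k + j) (s := j) (by omega)
  rw [Nat.add_sub_cancel] at h
  calc n.choose (k + j) ≤ n.choose (k + j) * (k + j).choose j :=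
        Nat.le_mul_of_pos_right _ (Nat.choose_pos (by omega))
    _ = n.choose j * (n - j).choose k := h
    _ ≤ n.choose j * (n - 1).choose k :=
        Nat.mul_le_mul_left _ (Nat.choose_le_choose _ (by omega))
    _ = _ := mul_comm _ _

lemma moveProb_nonneg (hp : 0 < p) (hp1 : p < 1) (k : ℕ) : 0 ≤ moveProb n p k := by
  rcases lt_or_ge k n with hk | hk
  · have hn : 0 < n := by omega
    have h1 := hitProb_pos hp hp1 hn
    have h2 := hitProb_lt_one (n := n) hp1
    have h3 := binomPMF_pos hp hp1 hk.le
    have h4 : 0 ≤ binomTail n p k := Finset.sum_nonneg fun j _ => binomPMF_nonneg hp hp1 _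
    have h5 : (0 : ℝ) < n - k := by
      have : (k : ℝ) < n := by exact_mod_cast hk
      linarith
    have h6 : 0 < 1 - hitProb n p := by linarith
    unfold moveProb
    positivity
  · have : binomTail n p k = 0 := by simp [binomTail, Nat.sub_eq_zero_of_le hk]
    simp [moveProb, this]

/-- Equivalent, after clearing denominators, to P(N > k)(1 - p)^n ≤ P(N > 0) C(n - 1, k) p^k (1 -
p)^(n - k), which holds term by term by `choose_add_le`. The bound keeps the total weight of the
moves at most 1. -/
lemma moveProb_le_one (hp : 0 < p) (hp1 : p < 1) (k : ℕ) : moveProb n p k ≤ 1 := by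
  rcases lt_or_ge k n with hk | hk
  · have hn : 0 < n := by omega
    have h1 := hitProb_pos hp hp1 hn
    have h3 := binomPMF_pos hp hp1 hk.le
    have h5 : (0 : ℝ) < n - k := by
      have : (k : ℝ) < n := by exact_mod_cast hk
      linarith
    have hn' : (0 : ℝ) < n := by exact_mod_cast hn
    have h1p : 0 < 1 - p := by linarith
    have hch : ((n : ℝ) - k) * n.choose k = n * (n - 1).choose k := by
      obtain ⟨m, rfl⟩ : ∃ m, n = m + 1 := ⟨n - 1, by omega⟩
      have := Nat.choose_mul_succ_eq m k
      have h2 := congrArg (Nat.cast : ℕ → ℝ) this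
      push_cast [Nat.cast_sub (show k ≤ m + 1 by omega)] at h2
      rw [Nat.add_sub_cancel]
      push_cast
      linarith
    have key : binomTail n p k * (1 - hitProb n p)
        ≤ hitProb n p * ((n - 1).choose k * p ^ k * (1 - p) ^ (n - k)) := by
      rw [← binomTail_zero (n := n)]
      have : 1 - binomTail n p 0 = (1 - p) ^ n := by rw [binomTail_zero]; simp [hitProb]
      rw [this]
      unfold binomTail
      rw [Nat.sub_zero, Finset.sum_mul, Finset.sum_mul]
      have hsub : Finset.range (n - k) ⊆ Finset.range n :=
        Finset.range_subset_range.2 (Nat.sub_le _ _)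
      refine le_trans (Finset.sum_le_sum fun j hj => ?_)
        (Finset.sum_le_sum_of_subset_of_nonneg hsub fun j _ _ =>
          mul_nonneg (binomPMF_nonneg hp hp1 _) (by positivity))
      rw [Finset.mem_range] at hj
      unfold binomPMF
      have e1 : (1 - p) ^ (n - (k + 1 + j)) * (1 - p) ^ n
          = (1 - p) ^ (n - (0 + 1 + j)) * (1 - p) ^ (n - k) := by
        rw [← pow_add, ← pow_add]; congr 1; omega
      have e2 : p ^ (k + 1 + j) = p ^ (0 + 1 + j) * p ^ k := by
        rw [← pow_add]; congr 1; omega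
      have e3 : (n.choose (k + 1 + j) : ℝ) ≤ (n - 1).choose k * n.choose (0 + 1 + j) := by
        have := choose_add_le (n := n) (k := k) (j := 0 + 1 + j) (by omega) (by omega)
        rw [show k + (0 + 1 + j) = k + 1 + j by omega] at this
        exact_mod_cast this
      calc (n.choose (k + 1 + j) : ℝ) * p ^ (k + 1 + j) * (1 - p) ^ (n - (k + 1 + j)) * (1 - p) ^ n
          = n.choose (k + 1 + j)
            * (p ^ (0 + 1 + j) * p ^ k * ((1 - p) ^ (n - (0 + 1 + j)) * (1 - p) ^ (n - k))) := by
            rw [← e1, ← e2]; ring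
        _ ≤ ((n - 1).choose k * n.choose (0 + 1 + j))
            * (p ^ (0 + 1 + j) * p ^ k * ((1 - p) ^ (n - (0 + 1 + j)) * (1 - p) ^ (n - k))) :=
            mul_le_mul_of_nonneg_right e3 (by positivity)
        _ = _ := by ring
    have hb : (n - 1).choose k * p ^ k * (1 - p) ^ (n - k) = (n - k) * binomPMF n p k / n := by
      unfold binomPMF
      field_simp
      linear_combination -hch
    rw [hb] at key
    unfold moveProb
    rw [div_mul_div_comm, div_le_one (by positivity)]
    have : (n : ℝ) * (binomTail n p k * ((1 - hitProb n p) / hitProb n p))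
        = n * (binomTail n p k * (1 - hitProb n p)) / hitProb n p := by ring
    rw [this, div_le_iff₀ h1]
    calc (n : ℝ) * (binomTail n p k * (1 - hitProb n p))
        ≤ n * (hitProb n p * ((n - k) * binomPMF n p k / n)) := by gcongr
      _ = _ := by field_simp
  · have : binomTail n p k = 0 := by simp [binomTail, Nat.sub_eq_zero_of_le hk]
    simp [moveProb, this]

end Binomial

/-! ### Moving a point: the size-bias identity -/

section HitCount

variable {E : Type*} {n : ℕ}

/-- The number of coordinates of `u` satisfying `b`. -/
def hitCount (b : E → Prop) [DecidablePred b] (u : Fin n → E) : ℕ := ∑ i, if b (u i) then 1 else 0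

lemma hitCount_le (b : E → Prop) [DecidablePred b] (u : Fin n → E) : hitCount b u ≤ n := by
  unfold hitCount
  calc _ ≤ ∑ _i : Fin n, 1 := Finset.sum_le_sum fun i _ => by split_ifs <;> simp
    _ = n := by simp

lemma hitCount_pos_iff (b : E → Prop) [DecidablePred b] (u : Fin n → E) :
    0 < hitCount b u ↔ ∃ i, b (u i) := by
  unfold hitCount
  rw [Finset.sum_pos_iff]
  constructor
  · rintro ⟨i, -, hi⟩
    by_contra h
    exact absurd hi (by simp [not_exists.1 h i])
  · rintro ⟨i, hi⟩
    exact ⟨i, Finset.mem_univ i, by simp [hi]⟩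

lemma hitCount_update_of_move {b : E → Prop} [DecidablePred b] (u : Fin n → E) (i : Fin n) (y : E)
    (hi : b (u i)) (hy : ¬ b y) : hitCount b (Function.update u i y) = hitCount b u - 1 := by
  unfold hitCount
  rw [← Finset.add_sum_erase _ _ (Finset.mem_univ i),
    ← Finset.add_sum_erase (a := i) Finset.univ (fun i => if b (u i) then 1 else 0)
      (Finset.mem_univ i)]
  have : ∑ x ∈ Finset.univ.erase i, (if b (Function.update u i y x) then 1 else 0)
      = ∑ x ∈ Finset.univ.erase i, if b (u x) then 1 else 0 := by
    refine Finset.sum_congr rfl fun k hk => ?_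
    rw [Function.update_of_ne (Finset.ne_of_mem_erase hk)]
  rw [this]
  simp [hi, hy]

end HitCount

section Resample

variable {E : Type*} [MeasurableSpace E] {ν : Measure E} [IsProbabilityMeasure ν] {n : ℕ}

/-- Exchanging the `i`-th coordinate with an independent copy. -/
def exchange (i : Fin n) (z : (Fin n → E) × E) : (Fin n → E) × E :=
  (Function.update z.1 i z.2, z.1 i)

lemma measurable_update_pair (i : Fin n) :
    Measurable fun z : (Fin n → E) × E => Function.update z.1 i z.2 := by
  rw [measurable_pi_iff]
  intro k
  by_cases h : k = i
  · subst h; simpa using measurable_snd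
  · simp only [Function.update_of_ne h]
    exact (measurable_pi_apply k).comp measurable_fst

lemma measurable_exchange (i : Fin n) : Measurable (exchange (E := E) i) :=
  (measurable_update_pair i).prodMk ((measurable_pi_apply i).comp measurable_fst)

/-- The n points and the extra one form an i.i.d. family indexed by `Option (Fin n)`, and the
exchange is a transposition of it. Both laws agree on boxes, where only the order of two factors
changes. -/
lemma measurePreserving_exchange (i : Fin n) :
    MeasurePreserving (exchange i) ((Measure.pi fun _ : Fin n => ν).prod ν)
      ((Measure.pi fun _ : Fin n => ν).prod ν) := by
  refine ⟨measurable_exchange i, ?_⟩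
  set μ := (Measure.pi fun _ : Fin n => ν).prod ν
  set Φ : (Fin n → E) × E → (Option (Fin n) → E) := fun z o => o.elim z.2 z.1 with hΦ
  set Ψ : (Option (Fin n) → E) → (Fin n → E) × E := fun v => (fun k => v (some k), v none) with hΨ
  have hΦm : Measurable Φ := by
    rw [measurable_pi_iff]
    rintro (_ | k)
    · exact measurable_snd
    · exact (measurable_pi_apply k).comp measurable_fst
  have hΨm : Measurable Ψ := by
    refine Measurable.prodMk ?_ (measurable_pi_apply _)
    rw [measurable_pi_iff]
    exact fun k => measurable_pi_apply _
  have hΨΦ : Ψ ∘ Φ = id := by ext z <;> rfl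
  have h1 : Measure.pi (fun _ : Option (Fin n) => ν) = μ.map Φ := by
    refine Measure.pi_eq fun s hs => ?_
    rw [Measure.map_apply hΦm (MeasurableSet.univ_pi hs)]
    have : Φ ⁻¹' Set.univ.pi s = (Set.univ.pi fun k => s (some k)) ×ˢ s none := by
      ext z
      simp [hΦ, Set.mem_pi, Option.forall, and_comm]
    rw [this, Measure.prod_prod, Measure.pi_pi, Fintype.prod_option, mul_comm]
  have h2 : Measure.pi (fun _ : Option (Fin n) => ν) = μ.map (Φ ∘ exchange i) := by
    refine Measure.pi_eq fun s hs => ?_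
    rw [Measure.map_apply (hΦm.comp (measurable_exchange i)) (MeasurableSet.univ_pi hs)]
    have : (Φ ∘ exchange i) ⁻¹' Set.univ.pi s
        = (Set.univ.pi (Function.update (fun k => s (some k)) i (s none))) ×ˢ s (some i) := by
      ext z
      simp only [hΦ, exchange, Set.mem_preimage, Function.comp_apply, Set.mem_pi, Set.mem_univ,
        true_implies, Option.forall, Option.elim_none, Option.elim_some, Set.mem_prod]
      constructor
      · rintro ⟨h0, h⟩
        refine ⟨fun k => ?_, by simpa using h i⟩
        by_cases hk : k = i
        · subst hk; simpa using h0
        · simpa [hk] using h k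
      · rintro ⟨h, h0⟩
        refine ⟨by simpa using h i, fun k => ?_⟩
        by_cases hk : k = i
        · subst hk; simpa using h0
        · simpa [hk] using h k
    rw [this, Measure.prod_prod, Measure.pi_pi, Fintype.prod_option]
    have e : ∀ k, ν (Function.update (fun k => s (some k)) i (s none) k)
        = Function.update (fun k => ν (s (some k))) i (ν (s none)) k := by
      intro k
      by_cases hk : k = i
      · subst hk; simp
      · simp [hk]
    simp_rw [e]
    rw [Finset.prod_update_of_mem (Finset.mem_univ i), mul_assoc]
    congr 1
    rw [Finset.sdiff_singleton_eq_erase, mul_comm]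
    exact Finset.mul_prod_erase Finset.univ (fun k => ν (s (some k))) (Finset.mem_univ i)
  have h3 : (μ.map Φ).map Ψ = μ := by
    rw [Measure.map_map hΨm hΦm, hΨΦ, Measure.map_id]
  calc μ.map (exchange i) = (μ.map (Φ ∘ exchange i)).map Ψ := by
        rw [Measure.map_map hΨm (hΦm.comp (measurable_exchange i)), ← Function.comp_assoc, hΨΦ]
        rfl
    _ = (μ.map Φ).map Ψ := by rw [← h2, h1]
    _ = μ := h3

lemma integral_exchange (i : Fin n) {H : (Fin n → E) × E → ℝ} (hH : Measurable H) :
    ∫ z, H (exchange i z) ∂((Measure.pi fun _ : Fin n => ν).prod ν)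
      = ∫ z, H z ∂((Measure.pi fun _ : Fin n => ν).prod ν) := by
  have h := measurePreserving_exchange (ν := ν) i
  conv_rhs => rw [← h.map_eq]
  rw [integral_map h.measurable.aemeasurable hH.aestronglyMeasurable]

lemma measurable_hitCount {b : E → Prop} [DecidablePred b] (hb : MeasurableSet {y | b y}) :
    Measurable (hitCount (n := n) b) := by
  unfold hitCount
  refine Finset.measurable_sum _ fun i _ => ?_
  exact Measurable.ite ((measurable_pi_apply i) hb) measurable_const measurable_const

/-- The size-bias identity: conditioning a binomial point process on meeting `b` amounts to moving
at most one point into `b`. -/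
lemma integral_hit_eq {b : E → Prop} [DecidablePred b] (hb : MeasurableSet {y | b y}) {p : ℝ}
    (hp : 0 < p) (hp1 : p < 1) (hbp : ν.real {y | b y} = p) (hn : 0 < n)
    {G : (Fin n → E) → ℝ} (hG : Measurable G) {C : ℝ} (hC : ∀ u, |G u| ≤ C) :
    ∫ u, (if ∃ i, b (u i) then G u else 0) ∂(Measure.pi fun _ : Fin n => ν)
      = hitProb n p * (∫ u, G u ∂(Measure.pi fun _ : Fin n => ν)
        + ∑ i, ∫ z, (moveProb n p (hitCount b z.1) / (n * p) * (if b (z.1 i) then 0 else 1)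
            * (if b z.2 then 1 else 0)) * (G (Function.update z.1 i z.2) - G z.1)
              ∂((Measure.pi fun _ : Fin n => ν).prod ν)) := by
  set Q := Measure.pi fun _ : Fin n => ν
  set N : (Fin n → E) → ℕ := hitCount b
  have hN : Measurable N := measurable_hitCount hb
  set m := moveProb n p
  have hm0 : ∀ k, 0 ≤ m k := moveProb_nonneg hp hp1
  have hm1 : ∀ k, m k ≤ 1 := moveProb_le_one hp hp1
  have hmm : Measurable m := measurable_from_top
  have hbm : Measurable fun y => if b y then (1 : ℝ) else 0 :=
    Measurable.ite hb measurable_const measurable_const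
  have hbm' : Measurable fun y => if b y then (0 : ℝ) else 1 :=
    Measurable.ite hb measurable_const measurable_const
  have hib : ∫ y, (if b y then (1 : ℝ) else 0) ∂ν = p := by
    rw [← hbp, ← integral_indicator_one hb]
    congr 1
    ext y
    simp [Set.indicator_apply]
  have hib' : ∫ y, (if b y then (0 : ℝ) else 1) ∂ν = 1 - p := by
    have : ∀ y, (if b y then (0 : ℝ) else 1) = 1 - if b y then (1 : ℝ) else 0 := by
      intro y; split_ifs <;> simp
    simp_rw [this]
    rw [integral_sub (integrable_const _), hib]
    · simp
    · exact integrable_of_abs_le hbm 1 fun y => by split_ifs <;> simp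
  have mi : ∀ i : Fin n, Measurable fun u : Fin n → E => u i := fun i => measurable_pi_apply i
  have bound2 : ∀ x y z w : ℝ, |x| ≤ 1 → |y| ≤ 1 → |z| ≤ 1 → |w| ≤ C → |x * y * z * w| ≤ C := by
    intro x y z w hx hy hz hw
    rw [abs_mul, abs_mul, abs_mul]
    have h1 : |x| * |y| ≤ 1 := mul_le_one₀ hx (abs_nonneg _) hy
    have h2 : |x| * |y| * |z| ≤ 1 := mul_le_one₀ h1 (abs_nonneg _) hz
    exact (mul_le_of_le_one_left (abs_nonneg _) h2).trans hw
  have hmabs : ∀ k, |m k| ≤ 1 := fun k => by rw [abs_of_nonneg (hm0 k)]; exact hm1 k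
  have hib1 : ∀ y, |if b y then (1 : ℝ) else 0| ≤ 1 := fun y => by split_ifs <;> simp
  have hib2 : ∀ y, |if b y then (0 : ℝ) else 1| ≤ 1 := fun y => by split_ifs <;> simp
  have term : ∀ i, ∫ z, (m (N z.1) / (n * p) * (if b (z.1 i) then 0 else 1)
            * (if b z.2 then 1 else 0)) * (G (Function.update z.1 i z.2) - G z.1) ∂(Q.prod ν)
      = ∫ u, ((1 - p) * m (N u - 1) * (if b (u i) then 1 else 0)
          - p * m (N u) * (if b (u i) then 0 else 1)) / (n * p) * G u ∂Q := by
    intro i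
    have iA : Integrable (fun z : (Fin n → E) × E => m (N z.1) * (if b (z.1 i) then 0 else 1)
        * (if b z.2 then 1 else 0) * G (Function.update z.1 i z.2)) (Q.prod ν) := by
      refine integrable_of_abs_le ?_ C fun z =>
        bound2 _ _ _ _ (hmabs _) (hib2 _) (hib1 _) (hC _)
      exact (((hmm.comp (hN.comp measurable_fst)).mul (hbm'.comp ((mi i).comp measurable_fst))).mul
        (hbm.comp measurable_snd)).mul (hG.comp (measurable_update_pair i))
    have iB : Integrable (fun z : (Fin n → E) × E => m (N z.1) * (if b (z.1 i) then 0 else 1)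
        * (if b z.2 then 1 else 0) * G z.1) (Q.prod ν) := by
      refine integrable_of_abs_le ?_ C fun z =>
        bound2 _ _ _ _ (hmabs _) (hib2 _) (hib1 _) (hC _)
      exact (((hmm.comp (hN.comp measurable_fst)).mul (hbm'.comp ((mi i).comp measurable_fst))).mul
        (hbm.comp measurable_snd)).mul (hG.comp measurable_fst)
    -- Exchanging `z.1 i` with `z.2` transfers the move from `G` to the weight: the configuration
    -- after the move becomes the variable, the old position becomes independent and averages to 1 -
    -- p, and the earlier count reads N - 1.
    have eA : ∫ z, m (N z.1) * (if b (z.1 i) then 0 else 1)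
        * (if b z.2 then 1 else 0) * G (Function.update z.1 i z.2) ∂(Q.prod ν)
        = ∫ u, (1 - p) * (m (N u - 1) * (if b (u i) then 1 else 0) * G u) ∂Q := by
      set H : (Fin n → E) × E → ℝ := fun z => (m (N (Function.update z.1 i z.2))
        * (if b z.2 then 0 else 1) * (if b (z.1 i) then 1 else 0) * G z.1) with hH
      have hHm : Measurable H :=
        (((hmm.comp (hN.comp (measurable_update_pair i))).mul (hbm'.comp measurable_snd)).mul
          (hbm.comp ((mi i).comp measurable_fst))).mul (hG.comp measurable_fst)
      have e1 : ∀ z : (Fin n → E) × E, m (N z.1) * (if b (z.1 i) then 0 else 1)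
        * (if b z.2 then 1 else 0) * G (Function.update z.1 i z.2) = H (exchange i z) := by
        intro z
        simp [hH, exchange]
      simp_rw [e1]
      rw [integral_exchange i hHm]
      have e2 : ∀ z, H z = (m (N z.1 - 1) * (if b (z.1 i) then 1 else 0) * G z.1)
          * (if b z.2 then 0 else 1) := by
        intro z
        simp only [hH]
        by_cases h1 : b z.2
        · simp [h1]
        · by_cases h2 : b (z.1 i)
          · have : N (Function.update z.1 i z.2) = N z.1 - 1 := hitCount_update_of_move _ _ _ h2 h1
            rw [this]; simp [h1, h2]
          · simp [h2]
      simp_rw [e2]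
      rw [integral_prod_mul (fun u => m (N u - 1) * (if b (u i) then 1 else 0) * G u)
        (fun y => if b y then (0 : ℝ) else 1), hib', integral_const_mul, mul_comm]
    have eB : ∫ z, m (N z.1) * (if b (z.1 i) then 0 else 1)
        * (if b z.2 then 1 else 0) * G z.1 ∂(Q.prod ν)
        = ∫ u, p * (m (N u) * (if b (u i) then 0 else 1) * G u) ∂Q := by
      have e2 : ∀ z : (Fin n → E) × E, m (N z.1) * (if b (z.1 i) then 0 else 1)
        * (if b z.2 then 1 else 0) * G z.1 = (m (N z.1) * (if b (z.1 i) then 0 else 1) * G z.1)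
          * (if b z.2 then 1 else 0) := fun z => by ring
      simp_rw [e2]
      rw [integral_prod_mul (fun u => m (N u) * (if b (u i) then 0 else 1) * G u)
        (fun y => if b y then (1 : ℝ) else 0), hib, integral_const_mul, mul_comm]
    have iA' : Integrable (fun u => (1 - p) * (m (N u - 1) * (if b (u i) then 1 else 0) * G u))
        Q := by
      refine (integrable_of_abs_le (C := C) ?_ fun u => ?_).const_mul _
      · exact ((hmm.comp (hN.sub measurable_const)).mul (hbm.comp (mi i))).mul hG
      · simpa using bound2 _ _ 1 _ (hmabs (N u - 1)) (hib1 (u i)) (by simp) (hC u)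
    have iB' : Integrable (fun u => p * (m (N u) * (if b (u i) then 0 else 1) * G u)) Q := by
      refine (integrable_of_abs_le (C := C) ?_ fun u => ?_).const_mul _
      · exact ((hmm.comp hN).mul (hbm'.comp (mi i))).mul hG
      · simpa using bound2 _ _ 1 _ (hmabs (N u)) (hib2 (u i)) (by simp) (hC u)
    calc _ = ∫ z, (n * p : ℝ)⁻¹ * (m (N z.1) * (if b (z.1 i) then 0 else 1)
            * (if b z.2 then 1 else 0) * G (Function.update z.1 i z.2)
            - m (N z.1) * (if b (z.1 i) then 0 else 1)
            * (if b z.2 then 1 else 0) * G z.1) ∂(Q.prod ν) := by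
            congr 1; ext z; ring
      _ = (n * p : ℝ)⁻¹ * (∫ u, (1 - p) * (m (N u - 1) * (if b (u i) then 1 else 0) * G u) ∂Q
            - ∫ u, p * (m (N u) * (if b (u i) then 0 else 1) * G u) ∂Q) := by
            rw [integral_const_mul, integral_sub iA iB, eA, eB]
      _ = _ := by
            rw [← integral_sub iA' iB', ← integral_const_mul]
            congr 1; ext u; ring
  simp_rw [term]
  have iG : Integrable G Q := integrable_of_abs_le hG C hC
  have iT : ∀ i ∈ Finset.univ, Integrable (fun u => ((1 - p) * m (N u - 1)
      * (if b (u i) then 1 else 0) - p * m (N u) * (if b (u i) then 0 else 1)) / (n * p) * G u)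
      Q := by
    intro i _
    refine iG.bdd_mul (c := (|1 - p| + |p|) / |n * p|) ?_ (ae_of_all _ fun u => ?_)
    · exact (((((hmm.comp (hN.sub measurable_const)).const_mul (1 - p)).mul
        (hbm.comp (mi i))).sub (((hmm.comp hN).const_mul p).mul
        (hbm'.comp (mi i)))).div_const _).aestronglyMeasurable
    · rw [Real.norm_eq_abs, abs_div]
      refine div_le_div_of_nonneg_right ?_ (abs_nonneg _)
      refine (abs_sub _ _).trans ?_
      rw [abs_mul, abs_mul, abs_mul, abs_mul]
      have h1 : |m (N u - 1)| * |if b (u i) then (1 : ℝ) else 0| ≤ 1 :=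
        mul_le_one₀ (hmabs _) (abs_nonneg _) (hib1 _)
      have h2 : |m (N u)| * |if b (u i) then (0 : ℝ) else 1| ≤ 1 :=
        mul_le_one₀ (hmabs _) (abs_nonneg _) (hib2 _)
      have h3 := mul_le_mul_of_nonneg_left h1 (abs_nonneg (1 - p))
      have h4 := mul_le_mul_of_nonneg_left h2 (abs_nonneg p)
      linarith
  rw [← integral_finsetSum _ iT, ← integral_add iG (integrable_finsetSum _ iT),
    ← integral_const_mul]
  congr 1
  ext u
  have s1 : ∑ i, (if b (u i) then (1 : ℝ) else 0) = N u := by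
    simp [N, hitCount]
  have s2 : ∑ i, (if b (u i) then (0 : ℝ) else 1) = n - N u := by
    have : ∀ i, (if b (u i) then (0 : ℝ) else 1) = 1 - if b (u i) then (1 : ℝ) else 0 := by
      intro i; split_ifs <;> simp
    simp_rw [this]
    rw [Finset.sum_sub_distrib, s1]
    simp
  have s3 : ∑ i, ((1 - p) * m (N u - 1) * (if b (u i) then 1 else 0)
      - p * m (N u) * (if b (u i) then 0 else 1)) / (n * p) * G u
      = ((1 - p) * m (N u - 1) * N u - p * m (N u) * (n - N u)) / (n * p) * G u := by
    rw [← Finset.sum_mul, ← Finset.sum_div, Finset.sum_sub_distrib, ← Finset.mul_sum,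
      ← Finset.mul_sum, s1, s2]
  rw [s3]
  have hq := (hitProb_pos hp hp1 hn).ne'
  have hnp : (n : ℝ) * p ≠ 0 := by positivity
  by_cases hu : ∃ i, b (u i)
  · rw [if_pos hu]
    have hpos : 0 < N u := (hitCount_pos_iff b u).2 hu
    obtain ⟨k, hk⟩ : ∃ k, N u = k + 1 := ⟨N u - 1, by omega⟩
    have hkn : k < n := by
      have : N u ≤ n := hitCount_le b u
      omega
    have hrec := moveProb_recursion hp hp1 hkn
    rw [hk, Nat.add_sub_cancel]
    push_cast
    have : G u = hitProb n p * (1 / hitProb n p) * G u := by field_simp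
    conv_lhs => rw [this, ← hrec]
    ring
  -- On the event of no hit everything must cancel, which is why `moveProb` has to equal 1 at count
  -- 0.
  · rw [if_neg hu]
    have h0 : N u = 0 := by
      by_contra h
      exact hu ((hitCount_pos_iff b u).1 (Nat.pos_of_ne_zero h))
    have h1 : m 0 = 1 := moveProb_zero hp hp1 hn
    rw [h0, h1]
    field_simp
    simp

end Resample

/-! ### Coverage by a homogeneous relation -/

section CoverIndicator

variable {E : Type*} (r : E → E → Prop) [DecidableRel r] {n : ℕ}

/-- The indicator that `z` is related to one of the points `u i`. -/
def coverInd (u : Fin n → E) (z : E) : ℝ := if ∃ i, r z (u i) then 1 else 0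

lemma coverInd_nonneg (u : Fin n → E) (z : E) : 0 ≤ coverInd r u z := by
  unfold coverInd; split_ifs <;> simp

lemma coverInd_le_one (u : Fin n → E) (z : E) : coverInd r u z ≤ 1 := by
  unfold coverInd; split_ifs <;> simp

lemma abs_coverInd_le (u : Fin n → E) (z : E) : |coverInd r u z| ≤ 1 := by
  rw [abs_of_nonneg (coverInd_nonneg r u z)]; exact coverInd_le_one r u z

variable {r}

lemma coverInd_update_sub_le (u : Fin n → E) (i : Fin n) (y z : E) :
    coverInd r (Function.update u i y) z - coverInd r u z ≤ if r z y then 1 else 0 := by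
  by_cases hy : r z y
  · rw [if_pos hy]
    linarith [coverInd_le_one r (Function.update u i y) z, coverInd_nonneg r u z]
  · rw [if_neg hy]
    by_cases h : ∃ k, r z (Function.update u i y k)
    · obtain ⟨k, hk⟩ := h
      by_cases hki : k = i
      · subst hki; simp [hy] at hk
      · rw [Function.update_of_ne hki] at hk
        have : coverInd r u z = 1 := if_pos ⟨k, hk⟩
        linarith [coverInd_le_one r (Function.update u i y) z]
    · have : coverInd r (Function.update u i y) z = 0 := if_neg h
      linarith [coverInd_nonneg r u z]

/-- When `y` does not reach `z`, moving `u i` to `y` can only uncover `z`, and only if `u i` is the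
sole point covering it. At most one index contributes, which saves a factor n in the drift estimate.
-/
lemma sum_coverInd_update_mem (u : Fin n → E) (s : Fin n → ℝ) (hs0 : ∀ i, 0 ≤ s i)
    (hs1 : ∀ i, s i ≤ 1) (y z : E) (hy : ¬ r z y) :
    -1 ≤ ∑ i, s i * (coverInd r (Function.update u i y) z - coverInd r u z) ∧
      ∑ i, s i * (coverInd r (Function.update u i y) z - coverInd r u z) ≤ 0 := by
  have hle : ∀ i, coverInd r (Function.update u i y) z - coverInd r u z ≤ 0 := by
    intro i
    have := coverInd_update_sub_le (r := r) u i y z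
    rwa [if_neg hy] at this
  refine ⟨?_, Finset.sum_nonpos fun i _ => mul_nonpos_of_nonneg_of_nonpos (hs0 i) (hle i)⟩
  by_cases h : ∃ k, r z (u k)
  · obtain ⟨k, hk⟩ := h
    rw [Finset.sum_eq_single k]
    · have h1 := coverInd_nonneg r (Function.update u k y) z
      have h2 := coverInd_le_one r u z
      nlinarith [hs0 k, hs1 k]
    · intro i _ hik
      have h1 : coverInd r (Function.update u i y) z = 1 :=
        if_pos ⟨k, by rwa [Function.update_of_ne (Ne.symm hik)]⟩
      have h2 : coverInd r u z = 1 := if_pos ⟨k, hk⟩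
      rw [h1, h2]; ring
    · simp
  · have h2 : coverInd r u z = 0 := if_neg h
    refine le_trans (by norm_num) (Finset.sum_nonneg fun i _ => mul_nonneg (hs0 i) ?_)
    rw [h2, sub_zero]; exact coverInd_nonneg r _ z

lemma coverInd_update_eq (u : Fin n → E) (j : Fin n) (w z : E) (h1 : ¬ r z (u j)) (h2 : ¬ r z w) :
    coverInd r (Function.update u j w) z = coverInd r u z := by
  unfold coverInd
  congr 1
  apply propext
  constructor
  · rintro ⟨k, hk⟩
    by_cases hkj : k = j
    · subst hkj; simp [h2] at hk
    · exact ⟨k, by rwa [Function.update_of_ne hkj] at hk⟩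
  · rintro ⟨k, hk⟩
    by_cases hkj : k = j
    · subst hkj; exact absurd hk h1
    · exact ⟨k, by rwa [Function.update_of_ne hkj]⟩

/-- Effect on the increments of the cover indicator at `z` of relocating the point `u j` far
away from `y`. -/
lemma abs_sum_coverInd_diff_le (u : Fin n → E) (s : Fin n → ℝ) (hs0 : ∀ i, 0 ≤ s i)
    (hs1 : ∀ i, s i ≤ 1) (j : Fin n) (w y z : E) (hfar1 : r z (u j) → ¬ r z y)
    (hfar2 : r z w → ¬ r z y) :
    |∑ i, s i * (coverInd r (Function.update (Function.update u j w) i y) z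
        - coverInd r (Function.update u j w) z)
      - ∑ i, s i * (coverInd r (Function.update u i y) z - coverInd r u z)|
      ≤ (if r z (u j) then 1 else 0) + (if r z w then 1 else 0) := by
  by_cases h1 : r z (u j) ∨ r z w
  · have hy : ¬ r z y := h1.elim hfar1 hfar2
    have a1 := sum_coverInd_update_mem (r := r) u s hs0 hs1 y z hy
    have a2 := sum_coverInd_update_mem (r := r) (Function.update u j w) s hs0 hs1 y z hy
    have : (1 : ℝ) ≤ (if r z (u j) then 1 else 0) + (if r z w then 1 else 0) := by
      rcases h1 with h | h
      · rw [if_pos h]; split_ifs <;> norm_num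
      · rw [if_pos h]; split_ifs <;> norm_num
    refine le_trans ?_ this
    rw [abs_le]
    constructor <;> linarith [a1.1, a1.2, a2.1, a2.2]
  · rw [not_or] at h1
    have e : ∀ i, coverInd r (Function.update (Function.update u j w) i y) z
        = coverInd r (Function.update u i y) z := by
      intro i
      by_cases hij : i = j
      · subst hij; rw [Function.update_idem]
      · rw [Function.update_comm (Ne.symm hij)]
        refine coverInd_update_eq _ _ _ _ ?_ h1.2
        rw [Function.update_of_ne (Ne.symm hij)]; exact h1.1
    simp_rw [e, coverInd_update_eq u j w z h1.1 h1.2]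
    simp [h1.1, h1.2]

end CoverIndicator

/-! ### The weighted move coupling for the covered mass -/

section Coupling

variable {E : Type*} [MeasurableSpace E] (ν : Measure E)
  (r : E → E → Prop) [DecidableRel r] (n : ℕ)

/-- `n` times the measure of the set of points related to one of the `u i`. -/
noncomputable def coverMass (u : Fin n → E) : ℝ := n * ∫ z, coverInd r u z ∂ν

/-- The weight with which the coupling at `x` moves the point `u i` to `y`. -/
noncomputable def moveWeight (p : ℝ) (u : Fin n → E) (a : Fin n × E × E) : ℝ :=
  moveProb n p (hitCount (r a.2.1) u) / (n * p) * (if r a.2.1 (u a.1) then 0 else 1)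
    * (if r a.2.1 a.2.2 then 1 else 0)

/-- The conditional expected increment of the covered mass in the coupling. -/
noncomputable def coverDrift (p : ℝ) (u : Fin n → E) : ℝ :=
  ∫ a, moveWeight r n p u a * (coverMass ν r n (Function.update u a.1 a.2.2) - coverMass ν r n u)
    ∂(Measure.count.prod (ν.prod ν))

variable {ν r n} {p : ℝ}

lemma coverMass_nonneg (u : Fin n → E) : 0 ≤ coverMass ν r n u :=
  mul_nonneg (Nat.cast_nonneg _) (integral_nonneg fun z => coverInd_nonneg r u z)

variable [IsProbabilityMeasure ν]

lemma measurable_coverInd (hr : MeasurableSet {z : E × E | r z.1 z.2}) :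
    Measurable fun z : (Fin n → E) × E => coverInd r z.1 z.2 := by
  have : MeasurableSet {z : (Fin n → E) × E | ∃ i, r z.2 (z.1 i)} := by
    have : {z : (Fin n → E) × E | ∃ i, r z.2 (z.1 i)}
        = ⋃ i, (fun z : (Fin n → E) × E => (z.2, z.1 i)) ⁻¹' {z : E × E | r z.1 z.2} := by
      ext z; simp
    rw [this]
    exact MeasurableSet.iUnion fun i =>
      (measurable_snd.prodMk ((measurable_pi_apply i).comp measurable_fst)) hr
  exact Measurable.ite this measurable_const measurable_const

lemma measurable_coverMass (hr : MeasurableSet {z : E × E | r z.1 z.2}) :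
    Measurable (coverMass ν r n) :=
  ((measurable_coverInd hr).stronglyMeasurable.integral_prod_right (ν := ν)).measurable.const_mul _

lemma integrable_coverInd (hr : MeasurableSet {z : E × E | r z.1 z.2})
    (u : Fin n → E) : Integrable (coverInd r u) ν :=
  integrable_of_abs_le ((measurable_coverInd hr).comp measurable_prodMk_left) 1
    fun z => abs_coverInd_le r u z

lemma coverMass_le (hr : MeasurableSet {z : E × E | r z.1 z.2})
    (u : Fin n → E) : coverMass ν r n u ≤ n := by
  have : ∫ z, coverInd r u z ∂ν ≤ ∫ z, (1 : ℝ) ∂ν :=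
    integral_mono (integrable_coverInd hr u) (integrable_const _) fun z => coverInd_le_one r u z
  simp only [integral_const, probReal_univ, smul_eq_mul, mul_one] at this
  exact mul_le_of_le_one_right (Nat.cast_nonneg _) this

lemma abs_coverMass_le (hr : MeasurableSet {z : E × E | r z.1 z.2})
    (u : Fin n → E) : |coverMass ν r n u| ≤ n := by
  rw [abs_of_nonneg (coverMass_nonneg u)]; exact coverMass_le hr u

lemma measurable_moveWeight (hr : MeasurableSet {z : E × E | r z.1 z.2}) :
    Measurable fun z : (Fin n → E) × (Fin n × E × E) => moveWeight r n p z.1 z.2 := by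
  have hx : Measurable fun z : (Fin n → E) × (Fin n × E × E) => z.2.2.1 :=
    measurable_fst.comp (measurable_snd.comp measurable_snd)
  have hy : Measurable fun z : (Fin n → E) × (Fin n × E × E) => z.2.2.2 :=
    measurable_snd.comp (measurable_snd.comp measurable_snd)
  have hk : ∀ k, Measurable fun z : (Fin n → E) × (Fin n × E × E) => z.1 k := fun k =>
    (measurable_pi_apply k).comp measurable_fst
  have hcount : Measurable fun z : (Fin n → E) × (Fin n × E × E) => hitCount (r z.2.2.1) z.1 := by
    unfold hitCount
    refine Finset.measurable_sum _ fun i _ => ?_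
    exact Measurable.ite ((hx.prodMk (hk i)) hr) measurable_const measurable_const
  have hi : Measurable fun z : (Fin n → E) × (Fin n × E × E) => z.1 z.2.1 := by
    have h : Measurable fun w : (Fin n → E) × Fin n => w.1 w.2 :=
      measurable_from_prod_countable_left fun i => measurable_pi_apply i
    exact h.comp (measurable_fst.prodMk (measurable_fst.comp measurable_snd))
  have hm : Measurable (moveProb n p) := measurable_from_top
  unfold moveWeight
  exact (((hm.comp hcount).div_const _).mul
    (Measurable.ite ((hx.prodMk hi) hr) measurable_const measurable_const)).mul
    (Measurable.ite ((hx.prodMk hy) hr) measurable_const measurable_const)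

lemma measurable_coverMass_update (hr : MeasurableSet {z : E × E | r z.1 z.2}) :
    Measurable fun z : (Fin n → E) × (Fin n × E × E) =>
      coverMass ν r n (Function.update z.1 z.2.1 z.2.2.2) := by
  have h : Measurable fun w : ((Fin n → E) × E) × Fin n => Function.update w.1.1 w.2 w.1.2 :=
    measurable_from_prod_countable_left fun i => measurable_update_pair i
  have h2 : Measurable fun z : (Fin n → E) × (Fin n × E × E) =>
      (((z.1, z.2.2.2), z.2.1) : ((Fin n → E) × E) × Fin n) :=
    (measurable_fst.prodMk (measurable_snd.comp (measurable_snd.comp measurable_snd))).prodMk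
      (measurable_fst.comp measurable_snd)
  exact (measurable_coverMass hr).comp (h.comp h2)

end Coupling

lemma integral_count_prod {E : Type*} [MeasurableSpace E] {m : Measure E} [IsFiniteMeasure m]
    {n : ℕ} {F : Fin n × E → ℝ} (hF : Integrable F (Measure.count.prod m)) :
    ∫ a, F a ∂(Measure.count.prod m) = ∑ i, ∫ x, F (i, x) ∂m := by
  rw [integral_prod _ hF, integral_count]

section Relation

variable {E : Type*} [MeasurableSpace E] {r : E → E → Prop}

lemma measurableSet_rel_left (hr : MeasurableSet {z : E × E | r z.1 z.2}) (x : E) :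
    MeasurableSet {y | r x y} := measurable_prodMk_left hr

lemma measurableSet_rel_right (hr : MeasurableSet {z : E × E | r z.1 z.2}) (y : E) :
    MeasurableSet {x | r x y} := measurable_prodMk_right hr

lemma integral_relInd_left {ν : Measure E} [DecidableRel r] {p : ℝ}
    (hr : MeasurableSet {z : E × E | r z.1 z.2})
    (hrp : ∀ x, ν.real {y | r x y} = p) (x : E) :
    ∫ y, (if r x y then (1 : ℝ) else 0) ∂ν = p := by
  rw [← hrp x, ← integral_indicator_one (measurableSet_rel_left hr x)]
  congr 1
  ext y
  simp [Set.indicator_apply]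

lemma integral_relInd_right {ν : Measure E} [DecidableRel r] {p : ℝ}
    (hr : MeasurableSet {z : E × E | r z.1 z.2})
    (hsymm : ∀ x y, r x y → r y x) (hrp : ∀ x, ν.real {y | r x y} = p) (y : E) :
    ∫ x, (if r x y then (1 : ℝ) else 0) ∂ν = p := by
  rw [← integral_relInd_left hr hrp y]
  congr 1
  ext x
  have : r x y ↔ r y x := ⟨hsymm x y, hsymm y x⟩
  simp [this]

end Relation

section MoveWeight

variable {E : Type*} {r : E → E → Prop} [DecidableRel r] {n : ℕ} {p : ℝ}

lemma moveWeight_nonneg (hp : 0 < p) (hp1 : p < 1) (u : Fin n → E) (a : Fin n × E × E) :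
    0 ≤ moveWeight r n p u a := by
  have := moveProb_nonneg (n := n) hp hp1 (hitCount (r a.2.1) u)
  unfold moveWeight
  refine mul_nonneg (mul_nonneg (by positivity) ?_) ?_ <;> split_ifs <;> simp

lemma moveWeight_le (hp : 0 < p) (hp1 : p < 1) (u : Fin n → E) (a : Fin n × E × E) :
    moveWeight r n p u a ≤ 1 / (n * p) * if r a.2.1 a.2.2 then 1 else 0 := by
  have h0 := moveProb_nonneg (n := n) hp hp1 (hitCount (r a.2.1) u)
  have h1 := moveProb_le_one (n := n) hp hp1 (hitCount (r a.2.1) u)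
  unfold moveWeight
  refine mul_le_mul_of_nonneg_right ?_ (by split_ifs <;> simp)
  have h2 : moveProb n p (hitCount (r a.2.1) u) / (n * p) ≤ 1 / (n * p) :=
    div_le_div_of_nonneg_right h1 (by positivity)
  refine le_trans (mul_le_of_le_one_right (by positivity) (by split_ifs <;> simp)) h2

lemma moveWeight_le' (hp : 0 < p) (hp1 : p < 1) (u : Fin n → E) (a : Fin n × E × E) :
    moveWeight r n p u a ≤ 1 / (n * p) := by
  refine (moveWeight_le hp hp1 u a).trans (mul_le_of_le_one_right (by positivity) ?_)
  split_ifs <;> simp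

lemma abs_moveWeight_le (hp : 0 < p) (hp1 : p < 1) (u : Fin n → E) (a : Fin n × E × E) :
    |moveWeight r n p u a| ≤ 1 / (n * p) := by
  rw [abs_of_nonneg (moveWeight_nonneg hp hp1 u a)]; exact moveWeight_le' hp hp1 u a

end MoveWeight

/-! ### Size-bias identity, drift estimate and normal approximation for the covered mass -/

section Coupling

variable {E : Type*} [MeasurableSpace E] {ν : Measure E} [IsProbabilityMeasure ν]
  {r r₃ : E → E → Prop} [DecidableRel r] {n : ℕ} {p p₃ : ℝ}

lemma measurable_relInd (hr : MeasurableSet {z : E × E | r z.1 z.2}) :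
    Measurable fun z : E × E => if r z.1 z.2 then (1 : ℝ) else 0 :=
  Measurable.ite hr measurable_const measurable_const

lemma integrable_relInd_right (hr : MeasurableSet {z : E × E | r z.1 z.2}) (y : E) :
    Integrable (fun x => if r x y then (1 : ℝ) else 0) ν := by
  have h : Measurable fun x => if r x y then (1 : ℝ) else 0 :=
    Measurable.ite (measurableSet_rel_right hr y) measurable_const measurable_const
  exact integrable_of_abs_le h 1 fun z => by split_ifs <;> simp

lemma measurable_moveWeight_right (hr : MeasurableSet {z : E × E | r z.1 z.2}) (u : Fin n → E) :
    Measurable (moveWeight r n p u) := by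
  have h : Measurable (Function.uncurry (moveWeight r n p)) := measurable_moveWeight hr
  exact h.of_uncurry_left

lemma measurable_coverMass_update_right (hr : MeasurableSet {z : E × E | r z.1 z.2})
    (u : Fin n → E) :
    Measurable fun a : Fin n × E × E => coverMass ν r n (Function.update u a.1 a.2.2) := by
  have h : Measurable (Function.uncurry fun (u : Fin n → E) (a : Fin n × E × E) =>
      coverMass ν r n (Function.update u a.1 a.2.2)) := measurable_coverMass_update hr
  exact h.of_uncurry_left

/-- A move newly covers at most the ball of the new point. The reverse inequality is the same
statement for the move that undoes it. -/
lemma abs_coverMass_update_sub_le (hr : MeasurableSet {z : E × E | r z.1 z.2})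
    (hsymm : ∀ x y, r x y → r y x) (hrp : ∀ x, ν.real {y | r x y} = p)
    (u : Fin n → E) (i : Fin n) (y : E) :
    |coverMass ν r n (Function.update u i y) - coverMass ν r n u| ≤ n * p := by
  have key : ∀ (u : Fin n → E) (y : E),
      coverMass ν r n (Function.update u i y) - coverMass ν r n u ≤ n * p := by
    intro u y
    unfold coverMass
    rw [← mul_sub, ← integral_sub (integrable_coverInd hr _) (integrable_coverInd hr _)]
    refine mul_le_mul_of_nonneg_left ?_ (Nat.cast_nonneg _)
    rw [← integral_relInd_right hr hsymm hrp y]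
    exact integral_mono ((integrable_coverInd hr _).sub (integrable_coverInd hr _))
      (integrable_relInd_right hr y) fun z => coverInd_update_sub_le u i y z
  rw [abs_le]
  refine ⟨?_, key u y⟩
  have := key (Function.update u i y) (u i)
  rw [Function.update_idem, Function.update_eq_self] at this
  linarith

lemma integral_moveWeight_le (hr : MeasurableSet {z : E × E | r z.1 z.2}) (hp : 0 < p)
    (hp1 : p < 1) (hrp : ∀ x, ν.real {y | r x y} = p) (u : Fin n → E) :
    ∫ a, moveWeight r n p u a ∂(Measure.count.prod (ν.prod ν)) ≤ 1 := by
  have i1 : Integrable (moveWeight r n p u) (Measure.count.prod (ν.prod ν)) :=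
    integrable_of_abs_le (measurable_moveWeight_right hr u) _
      (abs_moveWeight_le hp hp1 u)
  have i0 : Integrable (fun z : E × E => if r z.1 z.2 then (1 : ℝ) else 0) (ν.prod ν) :=
    integrable_of_abs_le (measurable_relInd hr) 1 fun z => by split_ifs <;> simp
  rw [integral_count_prod i1]
  have h : ∀ i : Fin n, ∫ x, moveWeight r n p u (i, x) ∂(ν.prod ν) ≤ 1 / n := by
    intro i
    have : ∫ z : E × E, 1 / (n * p) * (if r z.1 z.2 then (1 : ℝ) else 0) ∂(ν.prod ν) = 1 / n := by
      rw [integral_const_mul, integral_prod _ i0]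
      simp_rw [integral_relInd_left hr hrp]
      simp
      field_simp
    rw [← this]
    refine integral_mono ?_ (i0.const_mul _) fun x => moveWeight_le hp hp1 u (i, x)
    have hm : Measurable fun x : E × E => (i, x) := measurable_prodMk_left
    exact integrable_of_abs_le ((measurable_moveWeight_right hr u).comp hm) _
      fun x => abs_moveWeight_le hp hp1 u (i, x)
  calc _ ≤ ∑ _i : Fin n, 1 / (n : ℝ) := Finset.sum_le_sum fun i _ => h i
    _ ≤ 1 := by
      simp
      exact mul_inv_le_one

/-- The size-bias identity for the covered mass. -/
lemma integral_coverMass_mul (hr : MeasurableSet {z : E × E | r z.1 z.2}) (hp : 0 < p)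
    (hp1 : p < 1) (hrp : ∀ x, ν.real {y | r x y} = p) (hn : 0 < n)
    {G : (Fin n → E) → ℝ} (hG : Measurable G) {C : ℝ} (hC : ∀ u, |G u| ≤ C) :
    ∫ u, coverMass ν r n u * G u ∂(Measure.pi fun _ => ν)
      = n * hitProb n p * (∫ u, G u ∂(Measure.pi fun _ => ν)
        + ∫ u, ∫ a, moveWeight r n p u a * (G (Function.update u a.1 a.2.2) - G u)
          ∂(Measure.count.prod (ν.prod ν)) ∂(Measure.pi fun _ => ν)) := by
  set Q := Measure.pi fun _ : Fin n => ν
  set Φ : (Fin n → E) × (Fin n × E × E) → ℝ := fun z => moveWeight r n p z.1 z.2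
      * (G (Function.update z.1 z.2.1 z.2.2.2) - G z.1) with hΦ
  have mΦ : Measurable Φ := by
    have h : Measurable fun w : ((Fin n → E) × E) × Fin n => Function.update w.1.1 w.2 w.1.2 :=
      measurable_from_prod_countable_left fun i => measurable_update_pair i
    have h2 : Measurable fun z : (Fin n → E) × (Fin n × E × E) =>
        (((z.1, z.2.2.2), z.2.1) : ((Fin n → E) × E) × Fin n) :=
      (measurable_fst.prodMk (measurable_snd.comp (measurable_snd.comp measurable_snd))).prodMk
        (measurable_fst.comp measurable_snd)
    exact (measurable_moveWeight hr).mul ((hG.comp (h.comp h2)).sub (hG.comp measurable_fst))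
  obtain ⟨K, bΦ⟩ : ∃ K, ∀ z, |Φ z| ≤ K := by
    refine ⟨1 / (n * p) * (2 * C), fun z => ?_⟩
    rw [abs_mul]
    refine mul_le_mul (abs_moveWeight_le hp hp1 _ _) ?_ (abs_nonneg _) (by positivity)
    refine (abs_sub _ _).trans ?_
    linarith [hC (Function.update z.1 z.2.1 z.2.2.2), hC z.1]
  have mux : Measurable fun w : (Fin n → E) × E => coverInd r w.1 w.2 * G w.1 :=
    (measurable_coverInd hr).mul (hG.comp measurable_fst)
  have iux : Integrable (Function.uncurry fun (u : Fin n → E) (x : E) => coverInd r u x * G u)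
      (Q.prod ν) := by
    refine integrable_of_abs_le mux C fun w => ?_
    simp only [Function.uncurry]
    rw [abs_mul]
    exact (mul_le_of_le_one_left (abs_nonneg _) (abs_coverInd_le r _ _)).trans (hC _)
  have e1 : ∫ u, coverMass ν r n u * G u ∂Q
      = n * ∫ x, ∫ u, coverInd r u x * G u ∂Q ∂ν := by
    rw [← integral_integral_swap iux, ← integral_const_mul]
    congr 1; ext u
    rw [integral_mul_const, coverMass]; ring
  have e2 : ∀ x, ∫ u, coverInd r u x * G u ∂Q = hitProb n p * (∫ u, G u ∂Q
      + ∑ i, ∫ z, Φ (z.1, (i, x, z.2)) ∂(Q.prod ν)) := by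
    intro x
    have := integral_hit_eq (b := r x) (measurableSet_rel_left hr x) hp hp1 (hrp x) hn hG hC
    refine Eq.trans ?_ this
    congr 1; ext u
    unfold coverInd
    split_ifs <;> simp
  have mperm : ∀ i : Fin n, Measurable fun w : ((Fin n → E) × E) × E =>
      ((w.1.1, (i, w.1.2, w.2)) : (Fin n → E) × (Fin n × E × E)) := fun i =>
    (measurable_fst.comp measurable_fst).prodMk (measurable_const.prodMk
      ((measurable_snd.comp measurable_fst).prodMk measurable_snd))
  have iux2 : ∀ i : Fin n, Integrable (Function.uncurry fun (u : Fin n → E) (x : E) =>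
      ∫ y, Φ (u, (i, x, y)) ∂ν) (Q.prod ν) := by
    intro i
    have : Integrable (fun w : ((Fin n → E) × E) × E => Φ (w.1.1, (i, w.1.2, w.2)))
        ((Q.prod ν).prod ν) :=
      integrable_of_abs_le (mΦ.comp (mperm i)) K fun w => bΦ _
    exact this.integral_prod_left
  have e3 : ∀ i : Fin n, ∫ x, ∫ z, Φ (z.1, (i, x, z.2)) ∂(Q.prod ν) ∂ν
      = ∫ u, ∫ z, Φ (u, (i, z)) ∂(ν.prod ν) ∂Q := by
    intro i
    have l1 : ∀ x, ∫ z, Φ (z.1, (i, x, z.2)) ∂(Q.prod ν)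
        = ∫ u, ∫ y, Φ (u, (i, x, y)) ∂ν ∂Q := by
      intro x
      refine integral_prod (fun z : (Fin n → E) × E => Φ (z.1, (i, x, z.2))) ?_
      refine integrable_of_abs_le ?_ K fun w => bΦ _
      exact mΦ.comp (measurable_fst.prodMk (measurable_const.prodMk
        (measurable_const.prodMk measurable_snd)))
    have l2 : ∀ u, ∫ z, Φ (u, (i, z)) ∂(ν.prod ν) = ∫ x, ∫ y, Φ (u, (i, x, y)) ∂ν ∂ν := by
      intro u
      refine integral_prod (fun z : E × E => Φ (u, (i, z))) ?_
      refine integrable_of_abs_le ?_ K fun w => bΦ _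
      exact mΦ.comp (measurable_const.prodMk (measurable_const.prodMk measurable_id))
    simp_rw [l1, l2]
    exact (integral_integral_swap (iux2 i)).symm
  have i3 : ∀ i : Fin n, Integrable (fun x => ∫ z, Φ (z.1, (i, x, z.2)) ∂(Q.prod ν)) ν := by
    intro i
    have : Integrable (fun w : E × ((Fin n → E) × E) => Φ (w.2.1, (i, w.1, w.2.2)))
        (ν.prod (Q.prod ν)) := by
      refine integrable_of_abs_le ?_ K fun w => bΦ _
      exact mΦ.comp ((measurable_fst.comp measurable_snd).prodMk (measurable_const.prodMk
        (measurable_fst.prodMk (measurable_snd.comp measurable_snd))))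
    exact this.integral_prod_left
  have i4 : ∀ i : Fin n, Integrable (fun u => ∫ z, Φ (u, (i, z)) ∂(ν.prod ν)) Q := by
    intro i
    have : Integrable (fun w : (Fin n → E) × (E × E) => Φ (w.1, (i, w.2)))
        (Q.prod (ν.prod ν)) := by
      refine integrable_of_abs_le ?_ K fun w => bΦ _
      exact mΦ.comp (measurable_fst.prodMk (measurable_const.prodMk measurable_snd))
    exact this.integral_prod_left
  have e4 : ∀ u, ∫ a, Φ (u, a) ∂(Measure.count.prod (ν.prod ν))
      = ∑ i, ∫ z, Φ (u, (i, z)) ∂(ν.prod ν) := by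
    intro u
    exact integral_count_prod (integrable_of_abs_le (mΦ.comp measurable_prodMk_left) K
      fun a => bΦ _)
  rw [e1]
  simp_rw [e2]
  rw [integral_const_mul, integral_add (integrable_const _) (integrable_finsetSum _ fun i _ => i3 i),
    integral_finsetSum _ fun i _ => i3 i]
  simp_rw [e3]
  change _ = n * hitProb n p * (∫ u, G u ∂Q + ∫ u, ∫ a, Φ (u, a) ∂(Measure.count.prod (ν.prod ν)) ∂Q)
  simp_rw [e4]
  rw [integral_finsetSum _ fun i _ => i4 i]
  simp
  ring

/-- Here `r₃` is a threefold enlargement of `r`. Centers x in `r₃` relation with the old or new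
position of the relocated point are few, and there the crude bound n on the summed drift is used.
For every other x neither the hit count nor the weights change, and the drift changes by at most 2.
-/
lemma abs_coverDrift_update_sub_le (hr : MeasurableSet {z : E × E | r z.1 z.2})
    (hsymm : ∀ x y, r x y → r y x) (hp : 0 < p) (hp1 : p < 1)
    (hrp : ∀ x, ν.real {y | r x y} = p) (hn : 0 < n)
    (hr₃ : ∀ w, MeasurableSet {x | r₃ x w}) (hr₃p : ∀ w, ν.real {x | r₃ x w} ≤ p₃)
    (htri : ∀ x y z w, r x y → r y z → r z w → r₃ x w)
    (u : Fin n → E) (j : Fin n) (w : E) :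
    |coverDrift ν r n p (Function.update u j w) - coverDrift ν r n p u|
      ≤ 2 * p + 4 * n * p * p₃ := by
  set X := coverMass ν r n with hX
  have hn' : (0 : ℝ) < n := by exact_mod_cast hn
  have hnp : 0 < n * p := by positivity
  set ψ : (Fin n → E) → E × E → ℝ := fun u z => ∑ i, moveWeight r n p u (i, z)
    * (X (Function.update u i z.2) - X u) with hψ
  have mterm : ∀ u, ∀ i : Fin n, Measurable fun z : E × E => moveWeight r n p u (i, z)
      * (X (Function.update u i z.2) - X u) := by
    intro u i
    have hm : Measurable fun z : E × E => (i, z) := measurable_prodMk_left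
    have h1 : Measurable fun z : E × E => moveWeight r n p u (i, z) :=
      (measurable_moveWeight_right hr u).comp hm
    have h2 : Measurable fun z : E × E => X (Function.update u i z.2) :=
      (measurable_coverMass_update_right hr u).comp hm
    exact h1.mul (h2.sub_const _)
  have bterm : ∀ u, ∀ i : Fin n, ∀ z : E × E, |moveWeight r n p u (i, z)
      * (X (Function.update u i z.2) - X u)| ≤ if r z.1 z.2 then 1 else 0 := by
    intro u i z
    rw [abs_mul, abs_of_nonneg (moveWeight_nonneg hp hp1 _ _)]
    calc _ ≤ (1 / (n * p) * if r z.1 z.2 then 1 else 0) * (n * p) :=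
          mul_le_mul (moveWeight_le hp hp1 u (i, z))
            (abs_coverMass_update_sub_le hr hsymm hrp u i z.2) (abs_nonneg _)
            (mul_nonneg (by positivity) (by split_ifs <;> simp))
      _ = _ := by field_simp
  have bterm1 : ∀ u, ∀ i : Fin n, ∀ z : E × E, |moveWeight r n p u (i, z)
      * (X (Function.update u i z.2) - X u)| ≤ 1 := fun u i z =>
    (bterm u i z).trans (by split_ifs <;> simp)
  have iterm : ∀ u, ∀ i : Fin n, Integrable (fun z : E × E => moveWeight r n p u (i, z)
      * (X (Function.update u i z.2) - X u)) (ν.prod ν) := fun u i =>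
    integrable_of_abs_le (mterm u i) 1 (bterm1 u i)
  have hT : ∀ u, coverDrift ν r n p u = ∫ z, ψ u z ∂(ν.prod ν) := by
    intro u
    have hi : Integrable (fun a : Fin n × E × E => moveWeight r n p u a
        * (X (Function.update u a.1 a.2.2) - X u)) (Measure.count.prod (ν.prod ν)) := by
      refine integrable_of_abs_le ?_ 1 fun a => bterm1 u a.1 a.2
      exact (measurable_moveWeight_right hr u).mul
        ((measurable_coverMass_update_right hr u).sub_const _)
    unfold coverDrift
    rw [integral_count_prod hi, integral_finsetSum _ fun i _ => iterm u i]
  have iψ : ∀ u, Integrable (ψ u) (ν.prod ν) := fun u =>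
    integrable_finsetSum _ fun i _ => iterm u i
  set I₃ : E → E → ℝ := fun v x => {x | r₃ x v}.indicator 1 x with hI₃
  have mI₃ : ∀ v, Measurable (I₃ v) := fun v => measurable_const.indicator (hr₃ v)
  have I₃0 : ∀ v x, 0 ≤ I₃ v x := fun v x => Set.indicator_nonneg (fun _ _ => zero_le_one) _
  have I₃1 : ∀ v x, I₃ v x ≤ 1 := fun v x => Set.indicator_le_self' (fun _ _ => zero_le_one) _
  -- Integrated over related pairs (x, y) this becomes (2 + 2n · 2p₃) p, the asserted bound.
  have pt : ∀ z : E × E, |ψ (Function.update u j w) z - ψ u z|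
      ≤ (2 + 2 * n * (I₃ (u j) z.1 + I₃ w z.1)) * if r z.1 z.2 then 1 else 0 := by
    rintro ⟨x, y⟩
    by_cases hxy : r x y
    swap
    · have : ∀ u, ψ u (x, y) = 0 := by
        intro u
        refine Finset.sum_eq_zero fun i _ => ?_
        simp [moveWeight, hxy]
      simp [this, hxy]
    simp only [hxy, if_true, mul_one]
    by_cases hbad : r₃ x (u j) ∨ r₃ x w
    · have hψb : ∀ u, |ψ u (x, y)| ≤ n := by
        intro u
        refine (Finset.abs_sum_le_sum_abs _ _).trans ?_
        calc _ ≤ ∑ _i : Fin n, (1 : ℝ) := Finset.sum_le_sum fun i _ => bterm1 u i (x, y)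
          _ = n := by simp
      have h1 : 1 ≤ I₃ (u j) x + I₃ w x := by
        rcases hbad with h | h
        · have : I₃ (u j) x = 1 := Set.indicator_of_mem (s := {x | r₃ x (u j)}) h 1
          linarith [I₃0 w x]
        · have : I₃ w x = 1 := Set.indicator_of_mem (s := {x | r₃ x w}) h 1
          linarith [I₃0 (u j) x]
      refine (abs_sub _ _).trans ?_
      nlinarith [hψb u, hψb (Function.update u j w)]
    · rw [not_or] at hbad
      have hself : ∀ v, r x v → r₃ x v := fun v h => htri x v x v h (hsymm _ _ h) h
      have hj : ¬ r x (u j) := fun h => hbad.1 (hself _ h)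
      have hw : ¬ r x w := fun h => hbad.2 (hself _ h)
      have hrel : ∀ i, r x (Function.update u j w i) ↔ r x (u i) := by
        intro i
        by_cases hi : i = j
        · subst hi; simp [hj, hw]
        · rw [Function.update_of_ne hi]
      have hcount : hitCount (r x) (Function.update u j w) = hitCount (r x) u := by
        unfold hitCount
        refine Finset.sum_congr rfl fun i _ => ?_
        simp [hrel i]
      set s : Fin n → ℝ := fun i => if r x (u i) then 0 else 1 with hs
      have hs0 : ∀ i, 0 ≤ s i := fun i => by simp only [hs]; split_ifs <;> simp
      have hs1 : ∀ i, s i ≤ 1 := fun i => by simp only [hs]; split_ifs <;> simp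
      set c := moveProb n p (hitCount (r x) u) / (n * p) with hc
      have hc0 : 0 ≤ c := div_nonneg (moveProb_nonneg hp hp1 _) hnp.le
      have hc1 : c ≤ 1 / (n * p) :=
        div_le_div_of_nonneg_right (moveProb_le_one hp hp1 _) hnp.le
      have isum : ∀ v : Fin n → E, Integrable (fun z => ∑ i, s i
          * (coverInd r (Function.update v i y) z - coverInd r v z)) ν := fun v =>
        integrable_finsetSum _ fun i _ =>
          ((integrable_coverInd hr _).sub (integrable_coverInd hr _)).const_mul _
      have hψc : ∀ v : Fin n → E, (∀ i, r x (v i) ↔ r x (u i)) →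
          hitCount (r x) v = hitCount (r x) u → ψ v (x, y) = c * n * ∫ z, ∑ i, s i
            * (coverInd r (Function.update v i y) z - coverInd r v z) ∂ν := by
        intro v hv hvc
        have hi : ∀ i, Integrable (fun z => s i
            * (coverInd r (Function.update v i y) z - coverInd r v z)) ν := fun i =>
          ((integrable_coverInd hr _).sub (integrable_coverInd hr _)).const_mul _
        rw [integral_finsetSum _ fun i _ => hi i, Finset.mul_sum]
        refine Finset.sum_congr rfl fun i _ => ?_
        rw [integral_const_mul, integral_sub (integrable_coverInd hr _) (integrable_coverInd hr _)]
        simp only [moveWeight, hvc, hxy, if_true, mul_one, hX, coverMass, hs, hv i]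
        ring
      rw [hψc u (fun i => Iff.rfl) rfl, hψc _ hrel hcount, ← mul_sub,
        ← integral_sub (isum _) (isum _), abs_mul, abs_of_nonneg (mul_nonneg hc0 hn'.le)]
      have irel : ∀ v, Integrable (fun z => if r z v then (1 : ℝ) else 0) ν :=
        integrable_relInd_right hr
      have hb := abs_integral_le_of_abs_le ((irel (u j)).add (irel w)) fun z =>
        abs_sum_coverInd_diff_le (r := r) u s hs0 hs1 j w y z
          (fun h h' => hbad.1 (htri x y z (u j) hxy (hsymm _ _ h') h))
          (fun h h' => hbad.2 (htri x y z w hxy (hsymm _ _ h') h))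
      rw [integral_add' (irel (u j)) (irel w), integral_relInd_right hr hsymm hrp,
        integral_relInd_right hr hsymm hrp] at hb
      -- The increments of coverage at z change only if z is related to `u j` or to `w`, a set of
      -- measure at most 2p. For such z the chain x, y, z and good position of x exclude `r z y`.
      have h2 : c * n * |∫ z, (∑ i, s i * (coverInd r (Function.update (Function.update u j w) i y) z
          - coverInd r (Function.update u j w) z) - ∑ i, s i * (coverInd r (Function.update u i y) z
          - coverInd r u z)) ∂ν| ≤ 1 / (n * p) * n * (p + p) := by
        gcongr
      refine h2.trans ?_
      have : 1 / (n * p) * n * (p + p) = 2 := by field_simp; ring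
      rw [this]
      have := I₃0 (u j) x
      have := I₃0 w x
      have : 0 ≤ 2 * n * (I₃ (u j) x + I₃ w x) := by positivity
      linarith
  rw [hT, hT, ← integral_sub (iψ _) (iψ _)]
  have mbound : Measurable fun z : E × E =>
      (2 + 2 * n * (I₃ (u j) z.1 + I₃ w z.1)) * (if r z.1 z.2 then (1 : ℝ) else 0) :=
    ((((mI₃ (u j)).comp measurable_fst).add ((mI₃ w).comp measurable_fst)).const_mul
      (2 * (n : ℝ)) |>.const_add 2).mul (measurable_relInd hr)
  have ibound : Integrable (fun z : E × E =>
      (2 + 2 * n * (I₃ (u j) z.1 + I₃ w z.1)) * (if r z.1 z.2 then (1 : ℝ) else 0))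
      (ν.prod ν) := by
    refine integrable_of_abs_le mbound (2 + 2 * n * 2) fun z => ?_
    have h1 := I₃0 (u j) z.1
    have h2 := I₃0 w z.1
    have h3 := I₃1 (u j) z.1
    have h4 := I₃1 w z.1
    have h5 : 0 ≤ 2 + 2 * n * (I₃ (u j) z.1 + I₃ w z.1) := by positivity
    have h6 : 2 + 2 * n * (I₃ (u j) z.1 + I₃ w z.1) ≤ 2 + 2 * n * 2 := by
      have : I₃ (u j) z.1 + I₃ w z.1 ≤ 2 := by linarith
      gcongr
    split_ifs
    · rw [mul_one, abs_of_nonneg h5]; exact h6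
    · rw [mul_zero, abs_zero]; positivity
  refine (abs_integral_le_of_abs_le ibound pt).trans ?_
  rw [integral_prod _ ibound]
  simp_rw [integral_const_mul, integral_relInd_left hr hrp]
  rw [integral_mul_const]
  have iI₃ : ∀ v, Integrable (I₃ v) ν := fun v => integrable_of_abs_le (mI₃ v) 1 fun x => by
    rw [abs_of_nonneg (I₃0 v x)]; exact I₃1 v x
  have iI₃s : Integrable (fun x => 2 * n * (I₃ (u j) x + I₃ w x)) ν :=
    ((iI₃ _).add (iI₃ _)).const_mul _
  rw [integral_add (integrable_const _) iI₃s, integral_const_mul, integral_add (iI₃ _) (iI₃ _)]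
  have hI : ∀ v, ∫ x, I₃ v x ∂ν ≤ p₃ := by
    intro v
    rw [integral_indicator_one (hr₃ v)]; exact hr₃p v
  simp only [integral_const, probReal_univ, smul_eq_mul, one_mul]
  have : (2 * n * (∫ x, I₃ (u j) x ∂ν + ∫ x, I₃ w x ∂ν)) * p ≤ 2 * n * (p₃ + p₃) * p := by
    gcongr
    · exact hI _
    · exact hI _
  linarith

lemma measurable_coverDrift (hr : MeasurableSet {z : E × E | r z.1 z.2}) :
    Measurable (coverDrift ν r n p) :=
  (((measurable_moveWeight hr).mul ((measurable_coverMass_update hr).sub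
    ((measurable_coverMass hr).comp measurable_fst))).stronglyMeasurable.integral_prod_right
      (ν := Measure.count.prod (ν.prod ν))).measurable

lemma abs_coverDrift_le (hr : MeasurableSet {z : E × E | r z.1 z.2})
    (hsymm : ∀ x y, r x y → r y x) (hp : 0 < p) (hp1 : p < 1)
    (hrp : ∀ x, ν.real {y | r x y} = p) (u : Fin n → E) :
    |coverDrift ν r n p u| ≤ n * p := by
  have i1 : Integrable (moveWeight r n p u) (Measure.count.prod (ν.prod ν)) :=
    integrable_of_abs_le (measurable_moveWeight_right hr u) _
      (abs_moveWeight_le hp hp1 u)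
  have : |coverDrift ν r n p u| ≤ ∫ a, moveWeight r n p u a * (n * p)
      ∂(Measure.count.prod (ν.prod ν)) := by
    refine abs_integral_le_of_abs_le (i1.mul_const _) fun a => ?_
    rw [abs_mul, abs_of_nonneg (moveWeight_nonneg hp hp1 u a)]
    exact mul_le_mul_of_nonneg_left (abs_coverMass_update_sub_le hr hsymm hrp u _ _)
      (moveWeight_nonneg hp hp1 u a)
  rw [integral_mul_const] at this
  exact this.trans (mul_le_of_le_one_left (by positivity)
    (integral_moveWeight_le hr hp hp1 hrp u))

lemma integral_coverMass (hr : MeasurableSet {z : E × E | r z.1 z.2}) (hp : 0 < p)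
    (hp1 : p < 1) (hrp : ∀ x, ν.real {y | r x y} = p) (hn : 0 < n) :
    ∫ u, coverMass ν r n u ∂(Measure.pi fun _ => ν) = n * hitProb n p := by
  have := integral_coverMass_mul hr hp hp1 hrp hn (G := fun _ => 1) measurable_const (C := 1)
    (by simp)
  simpa using this

/-- Kolmogorov bound for the measure covered by a homogeneous relation. -/
theorem kolmogorovDist_coverMass_le (hr : MeasurableSet {z : E × E | r z.1 z.2})
    (hsymm : ∀ x y, r x y → r y x) (hp : 0 < p) (hp1 : p < 1)
    (hrp : ∀ x, ν.real {y | r x y} = p) (hn : 0 < n)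
    (hr₃ : ∀ w, MeasurableSet {x | r₃ x w}) (hr₃p : ∀ w, ν.real {x | r₃ x w} ≤ p₃)
    (htri : ∀ x y z w, r x y → r y z → r z w → r₃ x w)
    (hσ : 0 < stdDev (Measure.pi fun _ => ν) (coverMass ν r n)) {B Δ : ℝ} (hB : n * p ≤ B)
    (hΔ0 : 0 ≤ Δ) (hΔ : n * ((2 * p + 4 * n * p * p₃) ^ 2 / 4) ≤ Δ ^ 2) :
    kolmogorovDist (Measure.pi fun _ => ν) (coverMass ν r n)
      ≤ (∫ u, coverMass ν r n u ∂(Measure.pi fun _ => ν))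
          / (5 * stdDev (Measure.pi fun _ => ν) (coverMass ν r n) ^ 2)
        * (√(11 * B ^ 2 / stdDev (Measure.pi fun _ => ν) (coverMass ν r n) + 5 * Δ)
          + 2 * B / √(stdDev (Measure.pi fun _ => ν) (coverMass ν r n))) ^ 2 := by
  set Q := Measure.pi fun _ : Fin n => ν
  set X := coverMass ν r n with hX
  have hXm : Measurable X := measurable_coverMass hr
  have hXb : ∀ u, |X u| ≤ n := abs_coverMass_le hr
  set μ := ∫ u, X u ∂Q with hμ
  set σ := stdDev Q X with hσdef
  have hn' : (0 : ℝ) < n := by exact_mod_cast hn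
  have hμ' : μ = n * hitProb n p := integral_coverMass hr hp hp1 hrp hn
  have hμ0 : 0 < μ := by rw [hμ']; exact mul_pos hn' (hitProb_pos hp hp1 hn)
  have hB0 : 0 < B := lt_of_lt_of_le (by positivity) hB
  have hσ2 : σ ^ 2 = variance X Q := Real.sq_sqrt (variance_nonneg _ _)
  set W : (Fin n → E) → ℝ := fun u => (X u - μ) / σ with hW
  have hWm : Measurable W := (hXm.sub_const _).div_const _
  set W' : (Fin n → E) → (Fin n × E × E) → ℝ :=
    fun u a => (X (Function.update u a.1 a.2.2) - μ) / σ with hW'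
  have hdiff : ∀ u a, W' u a - W u = (X (Function.update u a.1 a.2.2) - X u) / σ := by
    intro u a; simp only [hW, hW']; ring
  have hWb : ∀ u, |W u| ≤ (n + |μ|) / σ := by
    intro u
    rw [abs_div, abs_of_pos hσ]
    refine div_le_div_of_nonneg_right ?_ hσ.le
    exact (abs_sub _ _).trans (by linarith [hXb u])
  have hid : ∀ g : ℝ → ℝ, Continuous g → ∫ u, W u * g (W u) ∂Q = μ / σ *
      ∫ u, ∫ a, moveWeight r n p u a * (g (W' u a) - g (W u))
        ∂(Measure.count.prod (ν.prod ν)) ∂Q := by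
    intro g hg
    obtain ⟨C, hC⟩ : ∃ C, ∀ u, |g (W u)| ≤ C := by
      obtain ⟨C, hC⟩ := (isCompact_Icc (a := -((n + |μ|) / σ)) (b := (n + |μ|) / σ)).exists_bound_of_continuousOn
        hg.continuousOn
      exact ⟨C, fun u => hC _ (abs_le.1 (hWb u))⟩
    have hGm : Measurable fun u => g (W u) := hg.measurable.comp hWm
    have h := integral_coverMass_mul hr hp hp1 hrp hn hGm hC
    rw [← hμ'] at h
    have iG : Integrable (fun u => g (W u)) Q := integrable_of_abs_le hGm C hC
    have iXG : Integrable (fun u => X u * g (W u)) Q :=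
      integrable_of_abs_le (hXm.mul hGm) (n * C) fun u => by
        rw [abs_mul]; exact mul_le_mul (hXb u) (hC u) (abs_nonneg _) hn'.le
    have e : ∫ u, W u * g (W u) ∂Q = (∫ u, X u * g (W u) ∂Q - μ * ∫ u, g (W u) ∂Q) / σ := by
      rw [← integral_const_mul, ← integral_sub iXG (iG.const_mul _), ← integral_div]
      congr 1; ext u; simp only [hW]; ring
    rw [e, h]
    ring
  have hsq : ∫ u, W u ^ 2 ∂Q = 1 := by
    have e : ∀ u, W u ^ 2 = (X u - μ) ^ 2 / σ ^ 2 := fun u => by simp only [hW]; ring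
    simp_rw [e]
    rw [integral_div, ← variance_eq_integral hXm.aemeasurable, ← hσ2, div_self (by positivity)]
  have hvar : variance (fun u => ∫ a, moveWeight r n p u a * (W' u a - W u)
      ∂(Measure.count.prod (ν.prod ν))) Q ≤ (Δ / σ) ^ 2 := by
    have e : (fun u => ∫ a, moveWeight r n p u a * (W' u a - W u)
        ∂(Measure.count.prod (ν.prod ν))) = fun u => σ⁻¹ * coverDrift ν r n p u := by
      ext u
      unfold coverDrift
      rw [← integral_const_mul]
      congr 1; ext a
      rw [hdiff]; ring
    rw [e, variance_const_mul, div_pow, inv_pow, inv_mul_eq_div]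
    refine div_le_div_of_nonneg_right ?_ (by positivity)
    exact (variance_pi_le_of_bounded_differences ν n _ (measurable_coverDrift hr) (n * p)
      (2 * p + 4 * n * p * p₃) (abs_coverDrift_le hr hsymm hp hp1 hrp)
      (abs_coverDrift_update_sub_le hr hsymm hp hp1 hrp hn hr₃ hr₃p htri)).trans hΔ
  have hW'm : Measurable (Function.uncurry W') :=
    ((measurable_coverMass_update hr).sub_const _).div_const _
  have main := kolmogorov_le_of_standardized (P := Q) (τ := Measure.count.prod (ν.prod ν))
    (W := W) (W' := W') (l := moveWeight r n p) (M := μ / σ) (δ := B / σ) (Δ := Δ / σ)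
    hWm hW'm (measurable_moveWeight hr) (moveWeight_nonneg hp hp1) (moveWeight_le' hp hp1)
    (integral_moveWeight_le hr hp hp1 hrp) hWb (by positivity) (by positivity)
    (fun u a => by
      rw [hdiff, abs_div, abs_of_pos hσ]
      exact div_le_div_of_nonneg_right
        ((abs_coverMass_update_sub_le hr hsymm hrp u _ _).trans hB) hσ.le)
    (by positivity) hid hsq hvar
  refine main.trans (le_of_eq ?_)
  have hs : 0 < √σ := Real.sqrt_pos.2 hσ
  have hss : √σ ^ 2 = σ := Real.sq_sqrt hσ.le
  -- The standardized bound is applied with M = μ/σ, δ = B/σ and Δ/σ. Extracting 1/σ from the square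
  -- produces the prefactor μ/(5σ²).
  have e1 : 11 * (B / σ) ^ 2 + 5 * (Δ / σ) = (11 * B ^ 2 / σ + 5 * Δ) / σ := by
    field_simp
  rw [e1, Real.sqrt_div (by positivity)]
  have e2 : √(11 * B ^ 2 / σ + 5 * Δ) / √σ + 2 * (B / σ)
      = (√(11 * B ^ 2 / σ + 5 * Δ) + 2 * B / √σ) / √σ := by
    conv_lhs => rw [show B / σ = B / (√σ ^ 2) by rw [hss]]
    field_simp
  rw [e2, div_pow, hss]
  field_simp

end Coupling

/-! ### The torus -/

section Torus

variable {d n : ℕ}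

lemma side_pos (hn : 0 < n) : 0 < side d n := Real.rpow_pos_of_pos (by exact_mod_cast hn) _

lemma side_pow (hd : 1 ≤ d) : side d n ^ d = n := by
  unfold side
  rw [one_div, Real.rpow_inv_natCast_pow (Nat.cast_nonneg n) (by omega)]

/-- The lattice of translation vectors of the torus, as a group homomorphism. -/
noncomputable def latticeHom (d n : ℕ) : (Fin d → ℤ) →+ EuclideanSpace ℝ (Fin d) where
  toFun := latticeVec d n
  map_zero' := by ext i; simp [latticeVec]
  map_add' k l := by ext i; simp [latticeVec, mul_add]

lemma latticeVec_add (k l : Fin d → ℤ) :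
    latticeVec d n (k + l) = latticeVec d n k + latticeVec d n l := (latticeHom d n).map_add k l

lemma latticeVec_neg (k : Fin d → ℤ) : latticeVec d n (-k) = -latticeVec d n k :=
  (latticeHom d n).map_neg k

lemma latticeVec_zero : latticeVec d n 0 = 0 := (latticeHom d n).map_zero

lemma bddBelow_dist_lattice (x y : EuclideanSpace ℝ (Fin d)) :
    BddBelow (Set.range fun k : Fin d → ℤ => dist x (y + latticeVec d n k)) :=
  ⟨0, by rintro _ ⟨k, rfl⟩; exact dist_nonneg⟩

lemma torusDist_le (x y : EuclideanSpace ℝ (Fin d)) (k : Fin d → ℤ) :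
    torusDist d n x y ≤ dist x (y + latticeVec d n k) := ciInf_le (bddBelow_dist_lattice x y) k

lemma torusDist_le_dist (x y : EuclideanSpace ℝ (Fin d)) : torusDist d n x y ≤ dist x y := by
  simpa [latticeVec_zero] using torusDist_le (n := n) x y 0

lemma torusDist_comm (x y : EuclideanSpace ℝ (Fin d)) :
    torusDist d n x y = torusDist d n y x := by
  have h : ∀ x y : EuclideanSpace ℝ (Fin d), torusDist d n x y ≤ torusDist d n y x := by
    intro x y
    refine le_ciInf fun k => ?_
    refine (torusDist_le x y (-k)).trans (le_of_eq ?_)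
    rw [latticeVec_neg, dist_comm y, dist_eq_norm, dist_eq_norm]
    congr 1; abel
  exact le_antisymm (h x y) (h y x)

lemma torusDist_triangle (x y z : EuclideanSpace ℝ (Fin d)) :
    torusDist d n x z ≤ torusDist d n x y + torusDist d n y z := by
  refine le_ciInf_add_ciInf fun k l => ?_
  refine (torusDist_le x z (k + l)).trans ?_
  refine (dist_triangle x (y + latticeVec d n k) _).trans ?_
  rw [latticeVec_add, show z + (latticeVec d n k + latticeVec d n l)
    = (z + latticeVec d n l) + latticeVec d n k by abel, dist_add_right]

lemma torusDist_add_lattice (x y : EuclideanSpace ℝ (Fin d)) (l : Fin d → ℤ) :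
    torusDist d n x (y + latticeVec d n l) = torusDist d n x y := by
  have h : ∀ (y : EuclideanSpace ℝ (Fin d)) (l : Fin d → ℤ),
      torusDist d n x (y + latticeVec d n l) ≤ torusDist d n x y := by
    intro y l
    refine le_ciInf fun k => ?_
    refine (torusDist_le x _ (k - l)).trans (le_of_eq ?_)
    congr 1
    rw [sub_eq_add_neg, latticeVec_add, latticeVec_neg]; abel
  refine le_antisymm (h y l) ?_
  have := h (y + latticeVec d n l) (-l)
  rwa [add_assoc, ← latticeVec_add, add_neg_cancel, latticeVec_zero, add_zero] at this

lemma torusDist_add_left (x y : EuclideanSpace ℝ (Fin d)) :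
    torusDist d n x (x + y) = torusDist d n 0 y := by
  unfold torusDist
  congr 1; ext k
  rw [add_assoc, dist_eq_norm, dist_eq_norm]
  congr 1; abel

lemma measurable_torusDist :
    Measurable fun z : EuclideanSpace ℝ (Fin d) × EuclideanSpace ℝ (Fin d) =>
      torusDist d n z.1 z.2 := by
  unfold torusDist
  refine Measurable.iInf fun k => ?_
  exact (continuous_fst.dist (continuous_snd.add continuous_const)).measurable

lemma measurable_torusDist_right (x : EuclideanSpace ℝ (Fin d)) :
    Measurable (torusDist d n x) := by
  have h : Measurable (Function.uncurry (torusDist d n)) := measurable_torusDist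
  exact h.of_uncurry_left

lemma cube_eq_preimage : cube d n = (WithLp.ofLp : EuclideanSpace ℝ (Fin d) → (Fin d → ℝ)) ⁻¹'
    (Set.univ.pi fun _ => Set.Ico 0 (side d n)) := by
  ext x; simp [cube, Set.mem_pi]

lemma measurableSet_cube : MeasurableSet (cube d n) := by
  rw [cube_eq_preimage]
  exact (PiLp.volume_preserving_ofLp (Fin d)).measurable
    (MeasurableSet.univ_pi fun _ => measurableSet_Ico)

lemma volume_cube (hd : 1 ≤ d) : volume (cube d n) = n := by
  rw [cube_eq_preimage, (PiLp.volume_preserving_ofLp (Fin d)).measure_preimage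
    (MeasurableSet.univ_pi fun _ => measurableSet_Ico).nullMeasurableSet, volume_pi_pi]
  simp only [Real.volume_Ico, sub_zero, Finset.prod_const, Finset.card_univ, Fintype.card_fin]
  have hs : 0 ≤ side d n := Real.rpow_nonneg (Nat.cast_nonneg n) _
  rw [← ENNReal.ofReal_pow hs, side_pow hd, ENNReal.ofReal_natCast]

/-- Each coordinate has a unique integer translate in the half-open interval. -/
lemma isAddFundamentalDomain_cube (hn : 0 < n) :
    IsAddFundamentalDomain (latticeHom d n).range (cube d n) volume := by
  refine IsAddFundamentalDomain.mk' measurableSet_cube.nullMeasurableSet fun x => ?_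
  have hs : 0 < side d n := side_pos hn
  have hex : ∀ i, ∃! m : ℤ, x i + m • side d n ∈ Set.Ico 0 (0 + side d n) := fun i =>
    existsUnique_add_zsmul_mem_Ico hs (x i) 0
  choose k hk huniq using hex
  refine ⟨⟨latticeHom d n k, k, rfl⟩, fun i => ?_, ?_⟩
  · have := hk i
    change (latticeVec d n k + x) i ∈ Set.Ico 0 (side d n)
    simpa [latticeVec, mul_comm, add_comm] using this
  · rintro ⟨_, l, rfl⟩ hl
    have : l = k := by
      ext i
      refine huniq i (l i) ?_
      have : (latticeVec d n l + x) i ∈ Set.Ico 0 (side d n) := hl i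
      simpa [latticeVec, mul_comm, add_comm] using this
    subst this; rfl

instance : Countable (latticeHom d n).range :=
  Set.countable_coe_iff.2 (Set.countable_range (latticeHom d n))

-- The toroidal ball is invariant under the lattice, so its volume may be computed in any
-- fundamental domain. The cube translated by x reduces it to the ball about 0.
open scoped Pointwise in
lemma volume_torus_ball_eq (hn : 0 < n) (x : EuclideanSpace ℝ (Fin d)) (ρ : ℝ) :
    volume ({y | torusDist d n x y ≤ ρ} ∩ cube d n)
      = volume ({y | torusDist d n 0 y ≤ ρ} ∩ cube d n) := by
  have hfd := isAddFundamentalDomain_cube (d := d) hn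
  have hfd' := hfd.vadd_of_comm x
  have hm : ∀ x : EuclideanSpace ℝ (Fin d), MeasurableSet {y | torusDist d n x y ≤ ρ} := fun x =>
    measurable_torusDist_right x measurableSet_Iic
  rw [hfd.measure_set_eq hfd' (hm x)]
  · have : {y | torusDist d n x y ≤ ρ} ∩ (x +ᵥ cube d n)
        = x +ᵥ ({y | torusDist d n 0 y ≤ ρ} ∩ cube d n) := by
      rw [Set.vadd_set_inter]
      congr 1
      ext y
      rw [Set.mem_vadd_set_iff_neg_vadd_mem]
      change torusDist d n x y ≤ ρ ↔ torusDist d n 0 (-x + y) ≤ ρ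
      rw [← torusDist_add_left x (-x + y), add_neg_cancel_left]
    rw [this, measure_vadd]
  · rintro ⟨_, l, rfl⟩
    ext y
    change torusDist d n x (latticeVec d n l + y) ≤ ρ ↔ torusDist d n x y ≤ ρ
    rw [add_comm, torusDist_add_lattice]

lemma unitBallVolume_pos : 0 < unitBallVolume d := by
  unfold unitBallVolume
  have := Real.pi_pos
  have : 0 < Real.Gamma (1 + (d : ℝ) / 2) := Real.Gamma_pos_of_pos (by positivity)
  positivity

lemma phi_pos {ρ : ℝ} (hρ : 0 < ρ) : 0 < phi d ρ := mul_pos unitBallVolume_pos (pow_pos hρ d)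

lemma volume_closedBall_eq_phi (hd : 1 ≤ d) {r : ℝ} (hr : 0 ≤ r) :
    volume (Metric.closedBall (0 : EuclideanSpace ℝ (Fin d)) r) = ENNReal.ofReal (phi d r) := by
  have : Nonempty (Fin d) := ⟨⟨0, by omega⟩⟩
  rw [EuclideanSpace.volume_closedBall, ← ENNReal.ofReal_pow hr, ← ENNReal.ofReal_mul (by positivity),
    phi, unitBallVolume, mul_comm]
  rw [Fintype.card_fin]
  congr 2
  rw [Real.sqrt_eq_rpow, ← Real.rpow_natCast, ← Real.rpow_mul Real.pi_pos.le,
    add_comm (1 : ℝ)]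
  congr 2; ring

-- Folding the Euclidean ball into the cube covers the toroidal ball. Only an inequality holds in
-- general, as the folded pieces may overlap.
open scoped Pointwise in
lemma volume_torus_ball_le (hd : 1 ≤ d) (hn : 0 < n) (x : EuclideanSpace ℝ (Fin d)) {ρ : ℝ}
    (hρ : 0 ≤ ρ) :
    volume ({y | torusDist d n x y ≤ ρ} ∩ cube d n) ≤ ENNReal.ofReal (phi d ρ) := by
  rw [volume_torus_ball_eq hn]
  have hfd := isAddFundamentalDomain_cube (d := d) hn
  -- A strictly larger radius avoids having to show that the infimum defining the distance is
  -- attained. Continuity of φ in the radius then lets r decrease to ρ.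
  have h : ∀ r, ρ < r → volume ({y | torusDist d n 0 y ≤ ρ} ∩ cube d n)
      ≤ ENNReal.ofReal (phi d r) := by
    intro r hr
    rw [← volume_closedBall_eq_phi hd (hρ.trans hr.le), hfd.measure_eq_tsum (Metric.closedBall 0 r)]
    refine le_trans (measure_mono ?_) (measure_iUnion_le _)
    rintro y ⟨hy, hyc⟩
    have hlt : torusDist d n 0 y < r := lt_of_le_of_lt hy hr
    obtain ⟨k, hk⟩ := exists_lt_of_ciInf_lt hlt
    rw [Set.mem_iUnion]
    refine ⟨⟨latticeHom d n (-k), -k, rfl⟩, ?_, hyc⟩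
    rw [Set.mem_vadd_set_iff_neg_vadd_mem]
    rw [dist_comm] at hk
    change dist (-latticeVec d n (-k) + y) 0 ≤ r
    rw [latticeVec_neg, neg_neg, add_comm]
    exact hk.le
  have hcont : Filter.Tendsto (fun r => ENNReal.ofReal (phi d r)) (nhdsWithin ρ (Set.Ioi ρ))
      (nhds (ENNReal.ofReal (phi d ρ))) := by
    refine (ENNReal.continuous_ofReal.comp ?_).continuousAt.mono_left nhdsWithin_le_nhds
    unfold phi; fun_prop
  refine ge_of_tendsto hcont ?_
  filter_upwards [self_mem_nhdsWithin] with r hr using h r hr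

lemma volume_torus_ball_pos (hn : 0 < n) (x : EuclideanSpace ℝ (Fin d)) {ρ : ℝ}
    (hρ : 0 < ρ) : 0 < volume ({y | torusDist d n x y ≤ ρ} ∩ cube d n) := by
  set c : EuclideanSpace ℝ (Fin d) := WithLp.toLp 2 fun _ => side d n / 2
  -- Recentered at the midpoint of the cube, where a small Euclidean ball fits inside.
  rw [volume_torus_ball_eq hn, ← volume_torus_ball_eq hn c]
  have hs : 0 < side d n := side_pos hn
  refine lt_of_lt_of_le (Metric.measure_ball_pos volume c (lt_min hρ (half_pos hs)))
    (measure_mono fun y hy => ?_)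
  rw [Metric.mem_ball, lt_min_iff] at hy
  refine ⟨?_, fun i => ?_⟩
  · refine (torusDist_le_dist c y).trans ?_
    rw [dist_comm]; exact hy.1.le
  · have h1 : |y i - side d n / 2| ≤ dist y c := by
      have := PiLp.norm_apply_le (y - c) i
      simpa [dist_eq_norm, c] using this
    have h2 := abs_lt.1 (h1.trans_lt hy.2)
    exact ⟨by linarith [h2.1], by linarith [h2.2]⟩

/-- The uniform distribution on the cube. -/
noncomputable def unif (d n : ℕ) : Measure (EuclideanSpace ℝ (Fin d)) :=
  ProbabilityTheory.cond volume (cube d n)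

lemma isProbabilityMeasure_unif (hd : 1 ≤ d) (hn : 0 < n) : IsProbabilityMeasure (unif d n) := by
  refine cond_isProbabilityMeasure_of_finite ?_ ?_
  · rw [volume_cube hd]; simpa using hn.ne'
  · rw [volume_cube hd]; simp

lemma unif_real_apply (hd : 1 ≤ d) (s : Set (EuclideanSpace ℝ (Fin d))) :
    (unif d n).real s = volume.real (s ∩ cube d n) / n := by
  unfold unif Measure.real
  rw [cond_apply measurableSet_cube, volume_cube hd, ENNReal.toReal_mul, ENNReal.toReal_inv,
    Set.inter_comm, ENNReal.toReal_natCast, inv_mul_eq_div]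

lemma coverMass_unif (hd : 1 ≤ d) (hn : 0 < n) (ρ : ℝ) (u : Fin n → EuclideanSpace ℝ (Fin d)) :
    coverMass (unif d n) (fun x y => torusDist d n x y ≤ ρ) n u = coveredVolume d n ρ u := by
  have hmeas : MeasurableSet {z | ∃ i, torusDist d n z (u i) ≤ ρ} := by
    have : {z | ∃ i, torusDist d n z (u i) ≤ ρ} = ⋃ i, {z | torusDist d n (u i) z ≤ ρ} := by
      ext z; simp [torusDist_comm z]
    rw [this]
    exact MeasurableSet.iUnion fun i => measurable_torusDist_right (u i) measurableSet_Iic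
  have h1 : ∫ z, coverInd (fun x y => torusDist d n x y ≤ ρ) u z ∂(unif d n)
      = (unif d n).real {z | ∃ i, torusDist d n z (u i) ≤ ρ} := by
    rw [← integral_indicator_one hmeas]
    congr 1; ext z
    simp [coverInd, Set.indicator_apply]
  have h2 : {z | ∃ i, torusDist d n z (u i) ≤ ρ} ∩ cube d n = ⋃ i, torusBall d n ρ (u i) := by
    ext z
    simp [torusBall, torusDist_comm z, and_comm]
  unfold coverMass coveredVolume
  rw [h1, unif_real_apply hd, h2, mul_div_cancel₀]
  positivity

end Torus

/-! ### Covered volume on the torus: ball probabilities, nondegeneracy and the constant η_V -/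

section CoveredVolume

variable {d n : ℕ} {ρ : ℝ}

lemma unif_torus_ball_eq (hd : 1 ≤ d) (hn : 0 < n) (x : EuclideanSpace ℝ (Fin d)) (ρ : ℝ) :
    (unif d n).real {y | torusDist d n x y ≤ ρ} = (unif d n).real {y | torusDist d n 0 y ≤ ρ} := by
  rw [unif_real_apply hd, unif_real_apply hd, Measure.real, Measure.real,
    volume_torus_ball_eq hn]

lemma unif_torus_ball_pos (hd : 1 ≤ d) (hn : 0 < n) (x : EuclideanSpace ℝ (Fin d)) (hρ : 0 < ρ) :
    0 < (unif d n).real {y | torusDist d n x y ≤ ρ} := by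
  rw [unif_real_apply hd]
  refine div_pos (ENNReal.toReal_pos (volume_torus_ball_pos hn x hρ).ne' ?_) (by exact_mod_cast hn)
  refine ((measure_mono Set.inter_subset_right).trans_lt ?_).ne
  rw [volume_cube hd]; simp

lemma unif_torus_ball_le (hd : 1 ≤ d) (hn : 0 < n) (x : EuclideanSpace ℝ (Fin d)) (hρ : 0 < ρ) :
    (unif d n).real {y | torusDist d n x y ≤ ρ} ≤ phi d ρ / n := by
  rw [unif_real_apply hd]
  gcongr
  exact ENNReal.toReal_le_of_le_ofReal (phi_pos hρ).le (volume_torus_ball_le hd hn x hρ.le)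

lemma tendsto_unif_torus_ball (hd : 1 ≤ d) (hn : 0 < n) (x : EuclideanSpace ℝ (Fin d)) (ρ : ℝ) :
    Filter.Tendsto (fun s => (unif d n).real {y | torusDist d n x y ≤ s}) (nhdsWithin ρ (Set.Ioi ρ))
      (nhds ((unif d n).real {y | torusDist d n x y ≤ ρ})) := by
  have := isProbabilityMeasure_unif hd hn
  have hm := measurable_torusDist_right (n := n) x
  have := Measure.isProbabilityMeasure_map (μ := unif d n) hm.aemeasurable
  -- Ball probabilities as a function of the radius form a distribution function, hence are
  -- right-continuous.
  have hc : ∀ s, cdf ((unif d n).map (torusDist d n x)) s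
      = (unif d n).real {y | torusDist d n x y ≤ s} := fun s => by
    rw [cdf_eq_real, map_measureReal_apply hm measurableSet_Iic]; rfl
  simp only [← hc]
  exact ((cdf ((unif d n).map (torusDist d n x))).right_continuous ρ).mono Set.Ioi_subset_Ici_self

/-- If all centers lie within `ε` of the origin, the covered set lies in the ball of radius
`ρ + ε` about the origin. -/
lemma coverMass_unif_le_of_near_zero (hd : 1 ≤ d) (hn : 0 < n) {ε : ℝ}
    {u : Fin n → EuclideanSpace ℝ (Fin d)} (hu : ∀ i, torusDist d n 0 (u i) ≤ ε) :
    coverMass (unif d n) (fun x y => torusDist d n x y ≤ ρ) n u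
      ≤ n * (unif d n).real {y | torusDist d n 0 y ≤ ρ + ε} := by
  have hn' : (0 : ℝ) < n := by exact_mod_cast hn
  rw [coverMass_unif hd hn, unif_real_apply hd, mul_div_cancel₀ _ hn'.ne', coveredVolume]
  refine measureReal_mono (Set.iUnion_subset fun i y hy => ⟨?_, hy.1⟩) ?_
  · have := torusDist_triangle (n := n) 0 (u i) y
    simp only [Set.mem_ofPred_eq]
    linarith [hy.2, hu i]
  · refine ((measure_mono Set.inter_subset_right).trans_lt ?_).ne
    rw [volume_cube hd]; simp

lemma lt_hitProb {p : ℝ} (hp : 0 < p) (hp1 : p < 1) (hn : 2 ≤ n) : p < hitProb n p := by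
  have := pow_lt_self_of_lt_one₀ (sub_pos.2 hp1) (by linarith) (show 1 < n by omega)
  unfold hitProb
  linarith

/-- The covered mass is not almost surely constant. -/
lemma stdDev_coverMass_unif_pos (hd : 1 ≤ d) (hn : 2 ≤ n) (hρ : 0 < ρ)
    (hp1 : (unif d n).real {y | torusDist d n 0 y ≤ ρ} < 1) :
    0 < stdDev (Measure.pi fun _ => unif d n)
      (coverMass (unif d n) (fun x y => torusDist d n x y ≤ ρ) n) := by
  have hn0 : 0 < n := by omega
  have hn' : (0 : ℝ) < n := by exact_mod_cast hn0
  have := isProbabilityMeasure_unif hd hn0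
  set ν := unif d n
  set X := coverMass ν (fun x y => torusDist d n x y ≤ ρ) n with hX
  set Q : Measure (Fin n → EuclideanSpace ℝ (Fin d)) := Measure.pi fun _ => ν
  have hr : MeasurableSet {z : EuclideanSpace ℝ (Fin d) × EuclideanSpace ℝ (Fin d) |
      torusDist d n z.1 z.2 ≤ ρ} := measurable_torusDist measurableSet_Iic
  have hp := unif_torus_ball_pos hd hn0 0 hρ
  refine Real.sqrt_pos.2 ((variance_nonneg _ _).lt_of_ne' fun h0 => ?_)
  have hL : MemLp X 2 Q := MemLp.of_bound (measurable_coverMass hr).aestronglyMeasurable n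
    (Filter.Eventually.of_forall (abs_coverMass_le hr))
  have hae := ae_eq_integral_of_variance_eq_zero hL h0
  have hμ := integral_coverMass hr hp hp1 (fun x => unif_torus_ball_eq hd hn0 x ρ) hn0
  -- If the variance vanished, the covered mass would equal its mean n q almost surely. With
  -- positive probability all points lie within ε of the origin, which forces q ≤ ν(ball of radius ρ
  -- + ε). As ε tends to 0 this gives q ≤ p, contrary to q = 1 - (1 - p)^n > p.
  have key : ∀ ε, 0 < ε → hitProb n (ν.real {y | torusDist d n 0 y ≤ ρ})
      ≤ ν.real {y | torusDist d n 0 y ≤ ρ + ε} := by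
    intro ε hε
    have hpos : Q (Set.univ.pi fun _ => {y | torusDist d n 0 y ≤ ε}) ≠ 0 := by
      rw [Measure.pi_pi, Finset.prod_ne_zero_iff]
      intro _ _ h
      have := unif_torus_ball_pos (ρ := ε) hd hn0 0 hε
      rw [Measure.real, h] at this
      simp at this
    obtain ⟨u, hu, hue⟩ : ∃ u, u ∈ (Set.univ.pi fun _ : Fin n => {y | torusDist d n 0 y ≤ ε}) ∧
        X u = ∫ u, X u ∂Q := by
      by_contra! hcon
      exact hpos (measure_mono_null (fun u hu => hcon u hu) (ae_iff.1 hae))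
    have := coverMass_unif_le_of_near_zero (ρ := ρ) hd hn0 fun i => hu i (Set.mem_univ i)
    rw [← hX, hue, hμ] at this
    exact le_of_mul_le_mul_left this hn'
  refine (lt_hitProb hp hp1 hn).not_ge ?_
  refine ge_of_tendsto (tendsto_unif_torus_ball hd hn0 0 ρ) ?_
  filter_upwards [self_mem_nhdsWithin] with s hs
  simpa using key (s - ρ) (sub_pos.2 hs)

lemma phi_mul (c : ℝ) : phi d (c * ρ) = c ^ d * phi d ρ := by
  unfold phi; ring

/-- A lower bound for `etaV` by its leading square. -/
lemma sq_le_etaV (hd : 1 ≤ d) (hρ : 0 < ρ) (hnφ : 6 ^ d * phi d ρ < n) :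
    (phi d ρ * (1 + 2 * 3 ^ d * phi d ρ)) ^ 2 ≤ etaV d n ρ := by
  have hφ := phi_pos (d := d) hρ
  have h6 : (6 : ℝ) ^ d = 3 ^ d * 2 ^ d := by rw [← mul_pow]; norm_num
  have h62 : (6 : ℝ) ^ (2 * d) = (6 ^ d) ^ 2 := by rw [mul_comm, pow_mul]
  have h3 : (3 : ℝ) ≤ 3 ^ d := le_self_pow₀ (by norm_num) (by omega)
  have h2 : (1 : ℝ) ≤ 2 ^ d := one_le_pow₀ (by norm_num)
  have h36 : (3 : ℝ) ^ d ≤ 6 ^ d := by gcongr; norm_num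
  have h26 : (3 : ℝ) * 2 ^ d ≤ 6 ^ d := by rw [h6]; gcongr
  unfold etaV
  set φ := phi d ρ
  have hn0 : (0 : ℝ) < n := lt_trans (by positivity) hnφ
  have hq : 1 ≤ (2 * n - 6 ^ d * φ) / (n - 6 ^ d * φ) := by
    rw [le_div_iff₀ (by linarith)]; linarith
  have hq' : 0 ≤ (2 * n - 3 * 2 ^ d * φ) / (n - 3 * 2 ^ d * φ) := by
    have : 3 * 2 ^ d * φ ≤ 6 ^ d * φ := by gcongr
    exact div_nonneg (by linarith) (by linarith)
  have e2 : (1 + 3 ^ d * φ) ^ 2 ≤ 1 + (2 ^ d + 1) * 6 ^ d * φ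
      + (2 * n - 6 ^ d * φ) / (n - 6 ^ d * φ) * 6 ^ (2 * d) * φ ^ 2 := by
    have f1 : 2 * (6 ^ d * φ) ≤ (2 ^ d + 1) * 6 ^ d * φ := by
      rw [mul_assoc]; gcongr; linarith
    have f2 : (6 ^ d * φ) ^ 2 ≤
        (2 * n - 6 ^ d * φ) / (n - 6 ^ d * φ) * 6 ^ (2 * d) * φ ^ 2 := by
      rw [h62, mul_assoc, ← mul_pow]
      exact le_mul_of_one_le_left (by positivity) hq
    have f3 : 3 ^ d * φ ≤ 6 ^ d * φ := by gcongr
    have f4 : (3 ^ d * φ) ^ 2 ≤ (6 ^ d * φ) ^ 2 := by gcongr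
    linarith
  have e3 : (1 : ℝ) + 3 ^ d * φ ≤ (3 ^ d + 1) * φ + 1 := by linarith
  -- One factor (1 + 3^d φ)² is absorbed by ((3^d + 1)φ + 1)², the other by the bracket of the first
  -- summand of `etaV`. The second summand is only used to be nonnegative.
  calc (φ * (1 + 2 * 3 ^ d * φ)) ^ 2
      ≤ (φ * ((1 + 3 ^ d * φ) * (1 + 3 ^ d * φ))) ^ 2 := by
        gcongr
        linarith [sq_nonneg (3 ^ d * φ)]
    _ = φ ^ 2 * (1 + 3 ^ d * φ) ^ 2 * (1 + 3 ^ d * φ) ^ 2 := by ring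
    _ ≤ 2 * φ ^ 2 * ((3 ^ d + 1) * φ + 1) ^ 2 * (1 + (2 ^ d + 1) * 6 ^ d * φ
          + (2 * n - 6 ^ d * φ) / (n - 6 ^ d * φ) * 6 ^ (2 * d) * φ ^ 2) := by
        have : φ ^ 2 ≤ 2 * φ ^ 2 := by linarith [sq_nonneg φ]
        gcongr
    _ ≤ _ := le_add_of_nonneg_right (by positivity)

end CoveredVolume

/-! ### Passage from the product measure to the given probability space -/

section Transfer

variable {Ω E : Type*} [MeasurableSpace Ω] [MeasurableSpace E] {P : Measure Ω}
  {X : E → ℝ} {T : Ω → E}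

lemma stdDev_map (hX : Measurable X) (hT : Measurable T) :
    stdDev (P.map T) X = stdDev P (X ∘ T) := by
  rw [stdDev, stdDev, variance_map hX.aemeasurable hT.aemeasurable]

lemma kolmogorovDist_map (hX : Measurable X) (hT : Measurable T) :
    kolmogorovDist (P.map T) X = kolmogorovDist P (X ∘ T) := by
  unfold kolmogorovDist
  rw [stdDev_map hX hT, integral_map hT.aemeasurable hX.aestronglyMeasurable]
  congr 1; ext t
  rw [map_measureReal_apply hT (measurableSet_le ((hX.sub_const _).div_const _) measurable_const)]
  rfl

end Transfer

end Coverage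

theorem theorem2p1 {Ω : Type*} [MeasurableSpace Ω] (P : Measure Ω) [IsProbabilityMeasure P]
    (d n : ℕ) (hd : 1 ≤ d) (hn : 4 ≤ n) (ρ : ℝ) (hρ : 0 < ρ)
    (U : Fin n → Ω → EuclideanSpace ℝ (Fin d))
    (hU_meas : ∀ i, Measurable (U i))
    (hU_indep : iIndepFun U P)
    (hU_unif : ∀ i, pdf.IsUniform (U i) (Coverage.cube d n) P volume)
    (V : Ω → ℝ) (hV : ∀ ω, V ω = Coverage.coveredVolume d n ρ (fun i => U i ω))
    (hnφ : 6 ^ d * Coverage.phi d ρ < n) :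
    MemLp V 2 P ∧ 0 < Coverage.stdDev P V ∧
      Coverage.kolmogorovDist P V ≤
        (∫ ω, V ω ∂P) / (5 * Coverage.stdDev P V ^ 2)
          * (√(11 * Coverage.phi d ρ ^ 2 / Coverage.stdDev P V
                + 5 * √(Coverage.etaV d n ρ) / √(n : ℝ))
              + 2 * Coverage.phi d ρ / √(Coverage.stdDev P V)) ^ 2 := by
  open Coverage in
  have hn0 : 0 < n := by omega
  have hn' : (0 : ℝ) < n := by exact_mod_cast hn0
  have := isProbabilityMeasure_unif hd hn0
  have hφ : 0 < phi d ρ := phi_pos hρ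
  set X := coverMass (unif d n) (fun x y => torusDist d n x y ≤ ρ) n with hX
  set T : Ω → Fin n → EuclideanSpace ℝ (Fin d) := fun ω i => U i ω
  have hr : MeasurableSet {z : EuclideanSpace ℝ (Fin d) × EuclideanSpace ℝ (Fin d) |
      torusDist d n z.1 z.2 ≤ ρ} := measurable_torusDist measurableSet_Iic
  have hXm : Measurable X := measurable_coverMass hr
  have hT : Measurable T := measurable_pi_lambda _ hU_meas
  have hVX : V = X ∘ T := by
    ext ω
    rw [hV, Function.comp_apply, hX, coverMass_unif hd hn0]
  -- Independence together with uniform marginals says exactly that the sample has the product law.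
  have hmap : Measure.pi (fun _ => unif d n) = P.map T := by
    rw [(iIndepFun_iff_map_fun_eq_pi_map fun i => (hU_meas i).aemeasurable).1 hU_indep]
    congr 1; ext1 i
    exact (hU_unif i).symm
  have hball := fun x => unif_torus_ball_eq hd hn0 x ρ
  have hp := unif_torus_ball_pos hd hn0 0 hρ
  have hpφ := unif_torus_ball_le hd hn0 0 hρ
  set p := (unif d n).real {y | torusDist d n 0 y ≤ ρ}
  have hp1 : p < 1 := by
    refine hpφ.trans_lt ((div_lt_one hn').2 (lt_of_le_of_lt ?_ hnφ))
    exact le_mul_of_one_le_left hφ.le (one_le_pow₀ (by norm_num))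
  have hsd := stdDev_coverMass_unif_pos hd (by omega) hρ hp1
  have hη := sq_le_etaV hd hρ hnφ
  have hη0 := (sq_nonneg _).trans hη
  -- The bounded-difference variance with p₃ = 3^d φ/n, the bound for a ball of radius 3ρ, and p ≤
  -- φ/n.
  have hΔ : n * ((2 * p + 4 * n * p * (3 ^ d * phi d ρ / n)) ^ 2 / 4)
      ≤ (√(etaV d n ρ) / √(n : ℝ)) ^ 2 := by
    rw [div_pow, Real.sq_sqrt hη0, Real.sq_sqrt hn'.le]
    calc n * ((2 * p + 4 * n * p * (3 ^ d * phi d ρ / n)) ^ 2 / 4)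
        ≤ n * ((2 * (phi d ρ / n) + 4 * n * (phi d ρ / n) * (3 ^ d * phi d ρ / n)) ^ 2 / 4) := by
          gcongr
      _ = (phi d ρ * (1 + 2 * 3 ^ d * phi d ρ)) ^ 2 / n := by field_simp; ring
      _ ≤ etaV d n ρ / n := by gcongr
  have main := kolmogorovDist_coverMass_le (ν := unif d n) (n := n) (p := p) hr
    (fun x y h => by rwa [torusDist_comm]) hp hp1 hball hn0
    (r₃ := fun x w => torusDist d n x w ≤ 3 * ρ) (p₃ := 3 ^ d * phi d ρ / n)
    (fun w => by
      simp only [torusDist_comm _ w]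
      exact measurable_torusDist_right w measurableSet_Iic)
    (fun w => by
      simp only [torusDist_comm _ w]
      rw [← phi_mul]
      exact unif_torus_ball_le hd hn0 w (by positivity))
    (fun x y z w h1 h2 h3 => by
      have e1 := torusDist_triangle (n := n) x y w
      have e2 := torusDist_triangle (n := n) y z w
      linarith)
    hsd (by rwa [mul_comm, ← le_div_iff₀ hn']) (by positivity) hΔ
  rw [← hX, hmap] at main hsd
  rw [stdDev_map hXm hT, ← hVX] at main hsd
  rw [kolmogorovDist_map hXm hT, integral_map hT.aemeasurable hXm.aestronglyMeasurable] at main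
  simp only [← Function.comp_apply (f := X) (g := T), ← hVX, ← mul_div_assoc] at main
  refine ⟨?_, hsd, main⟩
  refine MemLp.of_bound (hVX ▸ (hXm.comp hT)).aestronglyMeasurable n
    (Filter.Eventually.of_forall fun ω => ?_)
  rw [hVX]
  exact abs_coverMass_le hr _
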